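/- Notation. Let $\Omega\subset\mathbb R^d$ be open; $\omega\subset\subset\Omega$ means that $\omega$ is open with compact closure contained in $\Omega$. $\mathcal E(\Omega)=C^\infty(\Omega;\mathbb C)$, $\mathcal D(\Omega)$ is the space of test functions, $\mathcal E'(\Omega)$ the space of compactly supported distributions, and $\hat T(\xi)=\langle T,e^{-i\xi\cdot}\rangle$ for $T\in\mathcal E'(\Omega)$. Put $\|g\|_{W^{m,\infty}(\omega)}=\sup_{|\alpha|\le m}\|\partial^\alpha g\|_{L^\infty(\omega)}$. All nets are indexed by $\varepsilon\in(0,1)$ and all $O$, $o$ refer to $\varepsilon\to0^+$. $\mathcal E_M(\Omega)$ (resp. $\mathcal N(\Omega)$) is the space of nets $(g_\varepsilon)_\varepsilon$ in $\mathcal E(\Omega)$ such that for all $m\in\mathbb N_0$ and $\omega\subset\subset\Omega$ one has $\|g_\varepsilon\|_{W^{m,\infty}(\omega)}=O(\varepsilon^a)$ for some (resp. for every) $a\in\mathbb R$, and $\mathcal G(\Omega)=\mathcal E_M(\Omega)/\mathcal N(\Omega)$. The calibration of a net is $$c_{\omega,m}((g_\varepsilon)_\varepsilon)=\inf A,\qquad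 A=\{a\in\mathbb R:\ \varepsilon^a\|g_\varepsilon\|_{W^{m,\infty}(\omega)}=O(1)\};$$ it is reached at $s$ if $c_{\omega,m}((g_\varepsilon)_\varepsilon)=s\in A$. For $k\in\mathbb N_0$ and $s\in[-\infty,\infty)$, $(g_\varepsilon)_\varepsilon\in\mathcal E_M(\Omega)$ is of class $(k,s)$ if $$c_{\omega,i}((g_\varepsilon)_\varepsilon)\le s\ \text{ for all }\omega\subset\subset\Omega,\ 0\le i\le k,\quad\text{ and }\quad c_{\omega_1,k+1}((g_\varepsilon)_\varepsilon)>s\ \text{ for some }\omega_1\subset\subset\Omega, \tag{$*$}$$ and no pair $(k_1,s_1)$ with $s_1<s$, $k_1\in\mathbb N_0$ satisfies $(*)$. It is of class $(\infty,s)$ if $s<\infty$ is the infimum of all $a\in\mathbb R$ such that $\varepsilon^{a}\|\partial^\alpha g_\varepsilon\|_{L^\infty(\omega)}=O(1)$ for all $\omega\subset\subset\Omega$ and all $\alpha\in\mathbb N_0^d$. $\mathcal E_M^{k,s}(\Omega)$ is the set of moderate nets of some class $(i,h)$ with $i\in\{k,k+1,\dots\}\cup\{\infty\}$ and $h\le s$,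 and $\mathcal G^{k,s}(\Omega)\subset\mathcal G(\Omega)$ is the set of classes of its elements. Fix $\phi\in\mathcal S(\mathbb R^d)$ with $\int\phi=1$ and $\int t^m\phi(t)\,dt=0$ for all $m\in\mathbb N_0^d\setminus\{0\}$, and put $\phi_\varepsilon=\varepsilon^{-d}\phi(\cdot/\varepsilon)$; $\iota(T)\in\mathcal G(\Omega)$ is the class of the net $(T*\phi_\varepsilon|_\Omega)_\varepsilon$. Let $\theta\in\mathcal D(\mathbb R^d)$ be real-valued and radial, supported in the closed unit ball, with $\theta(y)=1$ for $|y|\le1/2$; put $\zeta(y)=-y\cdot\nabla\theta(y)$, $\varphi=\mathcal F^{-1}\theta$, $\psi=\mathcal F^{-1}\zeta$, where $\mathcal F^{-1}g(x)=(2\pi)^{-d}\int e^{ix\cdot\xi}g(\xi)\,d\xi$, and $\psi_\varepsilon=\varepsilon^{-d}\psi(\cdot/\varepsilon)$. For $r\in\mathbb R$, the Zygmund space is $$C_*^r=\Big\{u\in\mathcal S'(\mathbb R^d):\ \|\varphi*u\|_{L^\infty}+\sup_{0<\varepsilon<1}\varepsilon^{-r}\|\psi_\varepsilon*u\|_{L^\infty}<\infty\Big\}.$$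 Theorem. Let $T\in\mathcal E'(\Omega)$, $k\in\mathbb N_0$, and let $(f_\varepsilon)_\varepsilon\in\mathcal E_M^{k,0}(\Omega)$ be such that $\operatorname{supp}T\subset\omega$ and $\operatorname{supp}f_\varepsilon\subset\omega$ for all $\varepsilon\in(0,1)$, for some $\omega\subset\subset\Omega$. (1) Suppose that the calibration $c_{\omega,k}((f_\varepsilon)_\varepsilon)=0$ is reached at zero, or that $(f_\varepsilon)_\varepsilon\in\mathcal E_M^{k,s}(\Omega)$ for some $s<0$. Suppose further that $\langle T-f_\varepsilon,\rho\rangle=o(1)$ for every $\rho\in\mathcal D(\Omega)$. Then there is $C>0$ such that $$|\hat T(\xi)|\le C(1+|\xi|^2)^{-k/2}\qquad(\xi\in\mathbb R^d),$$ and moreover $\iota(T)\in\mathcal G^{k,d}(\Omega)$ and $T\in C_*^{k-d}$. (2) Suppose that $c_{\omega,k}((f_\varepsilon)_\varepsilon)=0$ but that the calibration is not reached at zero, and that $T$ and $(f_\varepsilon)_\varepsilon$ are strongly associated: there is $b>0$ such that $|\langle T-f_\varepsilon,\rho\rangle|=O(\varepsilon^b)$ for every $\rho\in\mathcal D(\Omega)$.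 Then for every $\eta>0$ there is $C>0$ such that $$|\hat T(\xi)|\le C(1+|\xi|^2)^{-k/2+\eta}\qquad(\xi\in\mathbb R^d),$$ and $T\in C_*^{k-d-\eta}$ for every $\eta\in(0,1)$. -/

import Mathlib

open scoped ContDiff ENNReal Topology Distributions SchwartzMap FourierTransform
open MeasureTheory TopologicalSpace Filter

noncomputable section

namespace Gen

/-- The Euclidean space `ℝᵈ`. -/
abbrev Eu (d : ℕ) : Type := EuclideanSpace ℝ (Fin d)

variable {d : ℕ}

/-! ### Smooth functions, relatively compact subsets, Sobolev seminorms -/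

/-- The space `𝓔(Ω)` of complex-valued smooth functions on the open set `Ω`. Its elements are
represented by functions on `ℝᵈ` that are smooth on `Ω`; the values off `Ω` play no role. -/
def smoothOn (Ω : Opens (Eu d)) : Submodule ℂ (Eu d → ℂ) where
  carrier := {f | ContDiffOn ℝ ∞ f Ω}
  add_mem' hf hg := ContDiffOn.add hf hg
  zero_mem' := contDiffOn_const
  smul_mem' c _ hf := ContDiffOn.const_smul c hf

/-- `U ⊂⊂ Ω`: `U` is open and its closure is a compact subset of `Ω`. -/
def RelCompact (U : Set (Eu d)) (Ω : Opens (Eu d)) : Prop :=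
  IsOpen U ∧ IsCompact (closure U) ∧ closure U ⊆ Ω

/-- The iterated partial derivative `∂_{i 0} ⋯ ∂_{i (n-1)} f` of order `n`. As `i` varies, these
are all the derivatives `∂^α f` with `|α| = n`. -/
def partialD {n : ℕ} (i : Fin n → Fin d) (f : Eu d → ℂ) (x : Eu d) : ℂ :=
  iteratedFDeriv ℝ n f x (fun j => EuclideanSpace.single (i j) 1)

/-- `‖∂_{i 0} ⋯ ∂_{i (n-1)} f‖_{L^∞(U)}`. -/
def partialNorm {n : ℕ} (i : Fin n → Fin d) (U : Set (Eu d)) (f : Eu d → ℂ) : ℝ≥0∞ :=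
  eLpNorm (partialD i f) ⊤ (volume.restrict U)

/-- `‖f‖_{W^{m,∞}(U)} = sup {‖∂^α f‖_{L^∞(U)} : |α| ≤ m}`. -/
def sobolevNorm (m : ℕ) (U : Set (Eu d)) (f : Eu d → ℂ) : ℝ≥0∞ :=
  ⨆ (n : ℕ) (_ : n ≤ m) (i : Fin n → Fin d), partialNorm i U f

/-- The support of a function on `Ω`: the closure in `Ω` of the set where it does not vanish. -/
def supportIn (Ω : Opens (Eu d)) (f : Eu d → ℂ) : Set (Eu d) :=
  closure {x | x ∈ Ω ∧ f x ≠ 0} ∩ Ω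

/-! ### Nets, moderate nets, negligible nets, the algebra `𝓖(Ω)` -/

/-- The parameter set `(0,1)` of all nets. -/
abbrev Eps : Type := Set.Ioo (0 : ℝ) 1

/-- The filter `ε → 0⁺` on `(0,1)`. -/
def epsZero : Filter Eps := comap (fun ε : Eps => (ε : ℝ)) (𝓝 0)

/-- Nets `(f_ε)_{ε ∈ (0,1)}` of smooth functions on `Ω`. -/
def Net (Ω : Opens (Eu d)) : Type := Eps → smoothOn Ω

instance (Ω : Opens (Eu d)) : AddCommGroup (Net Ω) := inferInstanceAs (AddCommGroup (Eps → smoothOn Ω))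

instance (Ω : Opens (Eu d)) : Module ℂ (Net Ω) := inferInstanceAs (Module ℂ (Eps → smoothOn Ω))

theorem Net.zero_apply {Ω : Opens (Eu d)} (ε : Eps) : (0 : Net Ω) ε = 0 := rfl

/-- `N ε = O(ε ^ b)` as `ε → 0⁺`. -/
def IsBigOPow (N : Eps → ℝ≥0∞) (b : ℝ) : Prop :=
  ∃ C : NNReal, ∀ᶠ ε in epsZero, N ε ≤ C * ENNReal.ofReal ((ε : ℝ) ^ b)

theorem IsBigOPow.mono {N N' : Eps → ℝ≥0∞} {b : ℝ} (h : IsBigOPow N b) (hle : ∀ ε, N' ε ≤ N ε) :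
    IsBigOPow N' b := by
  obtain ⟨C, hC⟩ := h
  exact ⟨C, hC.mono fun ε hε => (hle ε).trans hε⟩

theorem IsBigOPow.add {N N' : Eps → ℝ≥0∞} {b : ℝ} (h : IsBigOPow N b) (h' : IsBigOPow N' b) :
    IsBigOPow (fun ε => N ε + N' ε) b := by
  obtain ⟨C, hC⟩ := h
  obtain ⟨C', hC'⟩ := h'
  refine ⟨C + C', ?_⟩
  filter_upwards [hC, hC'] with ε h1 h2
  push_cast
  rw [add_mul]
  exact add_le_add h1 h2

theorem IsBigOPow.const_mul {N : Eps → ℝ≥0∞} {b : ℝ} (h : IsBigOPow N b) (c : NNReal) :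
    IsBigOPow (fun ε => c * N ε) b := by
  obtain ⟨C, hC⟩ := h
  refine ⟨c * C, ?_⟩
  filter_upwards [hC] with ε h1
  push_cast
  rw [mul_assoc]
  gcongr

theorem IsBigOPow.of_le {N : Eps → ℝ≥0∞} {b b' : ℝ} (h : IsBigOPow N b) (hb : b' ≤ b) :
    IsBigOPow N b' := by
  obtain ⟨C, hC⟩ := h
  refine ⟨C, hC.mono fun ε hε => hε.trans ?_⟩
  refine mul_le_mul_right (ENNReal.ofReal_le_ofReal ?_) _
  exact Real.rpow_le_rpow_of_exponent_ge ε.2.1 ε.2.2.le hb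

theorem contDiffAt_of_mem {Ω : Opens (Eu d)} (f : smoothOn Ω) {x : Eu d} (hx : x ∈ Ω) (n : ℕ) :
    ContDiffAt ℝ n (f : Eu d → ℂ) x :=
  (f.2.contDiffAt (Ω.isOpen.mem_nhds hx)).of_le (mod_cast le_top)

theorem sobolevNorm_zero (m : ℕ) (U : Set (Eu d)) : sobolevNorm m U (0 : Eu d → ℂ) = 0 := by
  have h : ∀ {n : ℕ} (i : Fin n → Fin d), partialD i (0 : Eu d → ℂ) = 0 := by
    intro n i
    ext x
    simp [partialD]
  simp [sobolevNorm, partialNorm, h]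

theorem sobolevNorm_add_le {Ω : Opens (Eu d)} (m : ℕ) {U : Set (Eu d)} (hU : RelCompact U Ω)
    (f g : smoothOn Ω) :
    sobolevNorm m U ((f + g : smoothOn Ω) : Eu d → ℂ) ≤ sobolevNorm m U f + sobolevNorm m U g := by
  refine iSup_le fun n => iSup_le fun hn => iSup_le fun i => ?_
  have h1 : partialNorm i U ((f + g : smoothOn Ω) : Eu d → ℂ)
      ≤ partialNorm i U f + partialNorm i U g := by
    have h : partialD i ((f + g : smoothOn Ω) : Eu d → ℂ) =ᵐ[volume.restrict U]
        partialD i f + partialD i g := by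
      refine (ae_restrict_iff' hU.1.measurableSet).2 (Eventually.of_forall fun x hx => ?_)
      have hxΩ : x ∈ Ω := hU.2.2 (subset_closure hx)
      simp only [partialD, Submodule.coe_add, Pi.add_apply]
      rw [iteratedFDeriv_add_apply (contDiffAt_of_mem f hxΩ n) (contDiffAt_of_mem g hxΩ n)]
      rfl
    simp only [partialNorm]
    rw [eLpNorm_congr_ae h]
    simp only [eLpNorm_exponent_top]
    exact eLpNormEssSup_add_le
  refine h1.trans (add_le_add ?_ ?_)
  · exact le_iSup_of_le n (le_iSup_of_le hn (le_iSup (fun i => partialNorm i U f) i))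
  · exact le_iSup_of_le n (le_iSup_of_le hn (le_iSup (fun i => partialNorm i U g) i))

theorem sobolevNorm_smul_le {Ω : Opens (Eu d)} (m : ℕ) {U : Set (Eu d)} (hU : RelCompact U Ω)
    (c : ℂ) (f : smoothOn Ω) :
    sobolevNorm m U ((c • f : smoothOn Ω) : Eu d → ℂ) ≤ ‖c‖₊ * sobolevNorm m U f := by
  refine iSup_le fun n => iSup_le fun hn => iSup_le fun i => ?_
  have h1 : partialNorm i U ((c • f : smoothOn Ω) : Eu d → ℂ) ≤ ‖c‖₊ * partialNorm i U f := by
    have h : partialD i ((c • f : smoothOn Ω) : Eu d → ℂ) =ᵐ[volume.restrict U]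
        c • partialD i f := by
      refine (ae_restrict_iff' hU.1.measurableSet).2 (Eventually.of_forall fun x hx => ?_)
      have hxΩ : x ∈ Ω := hU.2.2 (subset_closure hx)
      simp only [partialD, Submodule.coe_smul, Pi.smul_apply]
      rw [iteratedFDeriv_const_smul_apply (contDiffAt_of_mem f hxΩ n)]
      rfl
    simp only [partialNorm]
    rw [eLpNorm_congr_ae h]
    simp only [eLpNorm_exponent_top]
    exact eLpNormEssSup_const_smul_le
  refine h1.trans ?_
  gcongr
  exact le_iSup_of_le n (le_iSup_of_le hn (le_iSup (fun i => partialNorm i U f) i))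

/-- The space `𝓔_M(Ω)` of moderate nets. -/
def moderate (Ω : Opens (Eu d)) : Submodule ℂ (Net Ω) where
  carrier := {f | ∀ m : ℕ, ∀ U, RelCompact U Ω →
    ∃ a : ℝ, IsBigOPow (fun ε => sobolevNorm m U (f ε)) a}
  add_mem' {f g} hf hg m U hU := by
    obtain ⟨a, ha⟩ := hf m U hU
    obtain ⟨b, hb⟩ := hg m U hU
    exact ⟨min a b, ((ha.of_le (min_le_left _ _)).add (hb.of_le (min_le_right _ _))).mono
      fun ε => sobolevNorm_add_le m hU (f ε) (g ε)⟩
  zero_mem' m U _ := ⟨0, 0, Eventually.of_forall fun ε => by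
    simp only [Net.zero_apply, Submodule.coe_zero, sobolevNorm_zero]; exact zero_le⟩
  smul_mem' c f hf m U hU := by
    obtain ⟨a, ha⟩ := hf m U hU
    exact ⟨a, (ha.const_mul ‖c‖₊).mono fun ε => sobolevNorm_smul_le m hU c (f ε)⟩

/-- The space `𝓝(Ω)` of negligible nets. -/
def negligible (Ω : Opens (Eu d)) : Submodule ℂ (Net Ω) where
  carrier := {f | ∀ m : ℕ, ∀ U, RelCompact U Ω →
    ∀ b : ℝ, IsBigOPow (fun ε => sobolevNorm m U (f ε)) b}
  add_mem' {f g} hf hg m U hU b :=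
    ((hf m U hU b).add (hg m U hU b)).mono fun ε => sobolevNorm_add_le m hU (f ε) (g ε)
  zero_mem' m U _ b := ⟨0, Eventually.of_forall fun ε => by
    simp only [Net.zero_apply, Submodule.coe_zero, sobolevNorm_zero]; exact zero_le⟩
  smul_mem' c f hf m U hU b :=
    ((hf m U hU b).const_mul ‖c‖₊).mono fun ε => sobolevNorm_smul_le m hU c (f ε)

/-- The space `𝓖(Ω) = 𝓔_M(Ω) / 𝓝(Ω)` of Colombeau generalized functions (only its structure of a
vector space is needed). -/
abbrev Colombeau (Ω : Opens (Eu d)) : Type :=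
  moderate Ω ⧸ (negligible Ω).submoduleOf (moderate Ω)

/-! ### Calibrations and the classes `𝓔_M^{k,s}(Ω)`, `𝓖^{k,s}(Ω)` -/

/-- `A^m_{g,U} = {a ∈ ℝ : ε^a ‖g_ε‖_{W^{m,∞}(U)} = O(1)}`. -/
def exponents {Ω : Opens (Eu d)} (U : Set (Eu d)) (m : ℕ) (g : Net Ω) : Set ℝ :=
  {a | IsBigOPow (fun ε => ENNReal.ofReal ((ε : ℝ) ^ a) * sobolevNorm m U (g ε)) 0}

/-- The calibration `c_{U,m}(g) = inf A^m_{g,U}`. -/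
def calibration {Ω : Opens (Eu d)} (U : Set (Eu d)) (m : ℕ) (g : Net Ω) : EReal :=
  sInf ((fun a : ℝ => (a : EReal)) '' exponents U m g)

/-- The calibration `c_{U,m}(g)` equals `s` and is reached at `s`. -/
def CalibrationReachedAt {Ω : Opens (Eu d)} (U : Set (Eu d)) (m : ℕ) (g : Net Ω) (s : ℝ) : Prop :=
  calibration U m g = s ∧ s ∈ exponents U m g

/-- The growth condition in the definition of the class `(k,s)` for finite `k`. -/
def GrowthCond {Ω : Opens (Eu d)} (g : Net Ω) (k : ℕ) (s : EReal) : Prop :=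
  (∀ U, RelCompact U Ω → ∀ i ≤ k, calibration U i g ≤ s) ∧
    ∃ U, RelCompact U Ω ∧ s < calibration U (k + 1) g

/-- The net is of class `(k,s)`, for `k ∈ ℕ ∪ {∞}` and `s ∈ [-∞,∞)`. -/
def IsOfClass {Ω : Opens (Eu d)} (g : Net Ω) : ℕ∞ → EReal → Prop
  | (k : ℕ), s => s ≠ ⊤ ∧ GrowthCond g k s ∧ ¬ ∃ s₁ < s, ∃ k₁ : ℕ, GrowthCond g k₁ s₁
  | ⊤, s => s ≠ ⊤ ∧ s = sInf ((fun a : ℝ => (a : EReal)) '' {a | ∀ U, RelCompact U Ω →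
      ∀ (n : ℕ) (i : Fin n → Fin d),
        IsBigOPow (fun ε => ENNReal.ofReal ((ε : ℝ) ^ a) * partialNorm i U (g ε)) 0})

/-- `𝓔_M^{k,s}(Ω)`: the moderate nets that are of class `(i,h)` for some `i ≥ k` and `h ≤ s`. -/
def moderateClass (Ω : Opens (Eu d)) (k : ℕ∞) (s : EReal) : Set (Net Ω) :=
  {g | g ∈ moderate Ω ∧ ∃ i : ℕ∞, k ≤ i ∧ ∃ h : EReal, h ≤ s ∧ IsOfClass g i h}

/-- `𝓖^{k,s}(Ω) = 𝓔_M^{k,s}(Ω) / 𝓝(Ω)`, a subset of `𝓖(Ω)`. -/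
def colombeauClass (Ω : Opens (Eu d)) (k : ℕ∞) (s : EReal) : Set (Colombeau Ω) :=
  Submodule.Quotient.mk '' {g : moderate Ω | (g : Net Ω) ∈ moderateClass Ω k s}

/-! ### Dilations, convolutions with tempered distributions -/

/-- The dilation `x ↦ c⁻¹ x` of `ℝᵈ`. -/
def dilationEquiv (c : ℝ) (hc : 0 < c) : Eu d ≃L[ℝ] Eu d :=
  ContinuousLinearEquiv.smulLeft (Units.mk0 c⁻¹ (inv_ne_zero hc.ne'))

/-- `φ_c = c^{-d} φ(· / c)`. -/
def dilate (c : ℝ) (hc : 0 < c) (φ : 𝓢(Eu d, ℂ)) : 𝓢(Eu d, ℂ) :=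
  ((c : ℂ) ^ d)⁻¹ • SchwartzMap.compCLMOfContinuousLinearEquiv ℂ (dilationEquiv c hc) φ

theorem dilate_apply (c : ℝ) (hc : 0 < c) (φ : 𝓢(Eu d, ℂ)) (x : Eu d) :
    dilate c hc φ x = ((c : ℂ) ^ d)⁻¹ * φ (c⁻¹ • x) := rfl

/-- The function `y ↦ φ (x - y)`. -/
def reflectAt (φ : 𝓢(Eu d, ℂ)) (x : Eu d) : 𝓢(Eu d, ℂ) :=
  SchwartzMap.compSubConstCLM ℂ x
    (SchwartzMap.compCLMOfContinuousLinearEquiv ℂ (ContinuousLinearEquiv.neg ℝ) φ)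

theorem reflectAt_apply (φ : 𝓢(Eu d, ℂ)) (x y : Eu d) : reflectAt φ x y = φ (x - y) := by
  simp [reflectAt]

/-- The convolution `(u * φ)(x) = ⟨u(y), φ(x - y)⟩` of `u ∈ 𝓢'` with `φ ∈ 𝓢`. -/
def conv (u : 𝓢'(Eu d, ℂ)) (φ : 𝓢(Eu d, ℂ)) (x : Eu d) : ℂ := u (reflectAt φ x)

/-! ### Compactly supported distributions -/

theorem schwartz_mem_smoothOn (Ω : Opens (Eu d)) (φ : 𝓢(Eu d, ℂ)) :
    (φ : Eu d → ℂ) ∈ smoothOn Ω :=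
  (φ.smooth ⊤).contDiffOn

theorem testFunction_mem_smoothOn (Ω : Opens (Eu d)) (ρ : 𝓓(Ω, ℂ)) :
    (ρ : Eu d → ℂ) ∈ smoothOn Ω :=
  ρ.contDiff.contDiffOn

/-- The character `y ↦ e^{-i y·ξ}`. -/
def character (ξ : Eu d) (y : Eu d) : ℂ := Complex.exp (-Complex.I * (inner ℝ y ξ : ℝ))

theorem character_mem_smoothOn (Ω : Opens (Eu d)) (ξ : Eu d) : character ξ ∈ smoothOn Ω := by
  have h : ContDiff ℝ ∞ (character ξ) := by
    unfold character
    exact (contDiff_const.mul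
      (Complex.ofRealCLM.contDiff.comp (contDiff_id.inner ℝ contDiff_const))).cexp
  exact h.contDiffOn

/-- The space `𝓔'(Ω)` of compactly supported distributions: the linear functionals on `𝓔(Ω)` that
are continuous, i.e. bounded by a multiple of the maximum of the derivatives up to some order over
some compact subset of `Ω`. -/
structure CompactDistribution (Ω : Opens (Eu d)) where
  toLinearMap : smoothOn Ω →ₗ[ℂ] ℂ
  continuous' : ∃ (K : Set (Eu d)) (N : ℕ) (C : ℝ), IsCompact K ∧ K ⊆ Ω ∧ 0 ≤ C ∧
    ∀ (f : smoothOn Ω) (B : ℝ), 0 ≤ B →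
      (∀ n ≤ N, ∀ x ∈ K, ‖iteratedFDeriv ℝ n (f : Eu d → ℂ) x‖ ≤ B) → ‖toLinearMap f‖ ≤ C * B

namespace CompactDistribution

variable {Ω : Opens (Eu d)} (T : CompactDistribution Ω)

/-- The pairing `⟨T, ρ⟩` with a test function `ρ ∈ 𝓓(Ω)`. -/
def pair (ρ : 𝓓(Ω, ℂ)) : ℂ := T.toLinearMap ⟨ρ, testFunction_mem_smoothOn Ω ρ⟩

/-- The support of `T`. -/
def supp : Set (Eu d) := Distribution.dsupport T.pair

/-- The Fourier transform `T̂(ξ) = ⟨T, e^{-i ξ·}⟩`. -/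
def fourier (ξ : Eu d) : ℂ := T.toLinearMap ⟨character ξ, character_mem_smoothOn Ω ξ⟩

/-- `T` as a tempered distribution on `ℝᵈ`. -/
def toTempered : 𝓢'(Eu d, ℂ) :=
  ContinuousLinearMap.toPointwiseConvergenceCLM _ _ _ _
    (SchwartzMap.mkCLMtoNormedSpace (σ := RingHom.id ℂ)
      (fun φ => T.toLinearMap ⟨φ, schwartz_mem_smoothOn Ω φ⟩)
      (fun f g => T.toLinearMap.map_add ⟨f, schwartz_mem_smoothOn Ω f⟩
        ⟨g, schwartz_mem_smoothOn Ω g⟩)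
      (fun a f => T.toLinearMap.map_smul a ⟨f, schwartz_mem_smoothOn Ω f⟩)
      (by
        obtain ⟨K, N, C, -, -, hC, h⟩ := T.continuous'
        refine ⟨Finset.Iic (0, N), C, hC, fun f => h _ _ (apply_nonneg _ _) fun n hn x _ => ?_⟩
        have h1 := SchwartzMap.norm_iteratedFDeriv_le_seminorm ℂ f n x
        refine h1.trans ?_
        have h2 : schwartzSeminormFamily ℂ (Eu d) ℂ (0, n) ≤
            (Finset.Iic ((0 : ℕ), N)).sup (schwartzSeminormFamily ℂ (Eu d) ℂ) :=
          Finset.le_sup (f := schwartzSeminormFamily ℂ (Eu d) ℂ)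
            (Finset.mem_Iic.2 (Prod.mk_le_mk.2 ⟨le_rfl, hn⟩))
        exact h2 f))

theorem toTempered_apply (φ : 𝓢(Eu d, ℂ)) :
    T.toTempered φ = T.toLinearMap ⟨φ, schwartz_mem_smoothOn Ω φ⟩ := rfl

end CompactDistribution

/-- The pairing `⟨f, ρ⟩ = ∫_Ω f ρ` of a smooth function on `Ω` with a test function. -/
def pairSmooth {Ω : Opens (Eu d)} (f : smoothOn Ω) (ρ : 𝓓(Ω, ℂ)) : ℂ :=
  ∫ x in Ω, (f : Eu d → ℂ) x * ρ x

/-- `(f_ε) ∼ T`: `⟨T - f_ε, ρ⟩ = o(1)` for every test function `ρ`. -/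
def Associated {Ω : Opens (Eu d)} (f : Net Ω) (T : CompactDistribution Ω) : Prop :=
  ∀ ρ : 𝓓(Ω, ℂ), Tendsto (fun ε => T.pair ρ - pairSmooth (f ε) ρ) epsZero (𝓝 0)

/-- Strong association: `⟨T - f_ε, ρ⟩ = O(ε^b)` for every test function `ρ`, with the same
`b > 0` for all `ρ`. -/
def StronglyAssociated {Ω : Opens (Eu d)} (f : Net Ω) (T : CompactDistribution Ω) : Prop :=
  ∃ b : ℝ, 0 < b ∧ ∀ ρ : 𝓓(Ω, ℂ),
    (fun ε => T.pair ρ - pairSmooth (f ε) ρ) =O[epsZero] (fun ε : Eps => (ε : ℝ) ^ b)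

/-! ### Embedding of distributions -/

/-- A mollifier `φ ∈ 𝓢(ℝᵈ)` with `∫ φ = 1` and all other moments equal to zero. -/
def IsMollifier (φ : 𝓢(Eu d, ℂ)) : Prop :=
  ∫ t, φ t = 1 ∧
    ∀ m : Fin d → ℕ, m ≠ 0 → ∫ t : Eu d, (∏ j, ((t j : ℝ) : ℂ) ^ m j) * φ t = 0

/-- `ι(T) ∈ S`, where `ι(T) ∈ 𝓖(Ω)` is the class of the net `(T * φ_ε |_Ω)_ε`; that this net
consists of smooth functions and is moderate is part of the assertion. -/
def EmbeddingMem {Ω : Opens (Eu d)} (φ : 𝓢(Eu d, ℂ)) (T : CompactDistribution Ω)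
    (S : Set (Colombeau Ω)) : Prop :=
  ∃ g : moderate Ω,
    (∀ ε : Eps, ∀ x ∈ Ω, ((g : Net Ω) ε : Eu d → ℂ) x = conv T.toTempered (dilate ε ε.2.1 φ) x) ∧
      (Submodule.Quotient.mk g : Colombeau Ω) ∈ S

/-! ### Zygmund spaces -/

/-- The function `θ` of a continuous Littlewood-Paley decomposition: smooth, real-valued, radial,
supported in the closed unit ball, and equal to `1` on the ball of radius `1/2`. -/
structure LittlewoodPaley (d : ℕ) where
  θ : Eu d → ℝ
  smooth : ContDiff ℝ ∞ θ
  radial : ∀ x y, ‖x‖ = ‖y‖ → θ x = θ y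
  support : tsupport θ ⊆ Metric.closedBall 0 1
  eq_one : ∀ y, ‖y‖ ≤ 1 / 2 → θ y = 1

/-- The inverse Fourier transform with the normalization
`(𝓕⁻¹ g)(x) = (2π)^{-d} ∫ e^{i x·ξ} g(ξ) dξ` (Mathlib's is `∫ e^{2πi x·ξ} g(ξ) dξ`). -/
def invFourier (g : 𝓢(Eu d, ℂ)) : 𝓢(Eu d, ℂ) := dilate (2 * Real.pi) Real.two_pi_pos (𝓕⁻ g)

namespace LittlewoodPaley

variable (P : LittlewoodPaley d)

theorem hasCompactSupport : HasCompactSupport P.θ :=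
  (isCompact_closedBall (0 : Eu d) 1).of_isClosed_subset (isClosed_tsupport _) P.support

/-- `ζ(y) = - y · ∇θ(y)`. -/
def ζ (y : Eu d) : ℝ := -(fderiv ℝ P.θ y y)

theorem ζ_smooth : ContDiff ℝ ∞ P.ζ :=
  ((P.smooth.fderiv_right (m := ∞) le_rfl).clm_apply contDiff_id).neg

theorem ζ_hasCompactSupport : HasCompactSupport P.ζ := by
  refine (P.hasCompactSupport.fderiv ℝ).mono fun y hy h => hy ?_
  simp [ζ, h]

/-- `φ = 𝓕⁻¹ θ`. -/
def lowPass : 𝓢(Eu d, ℂ) :=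
  invFourier (HasCompactSupport.toSchwartzMap (f := fun y => (P.θ y : ℂ))
    (P.hasCompactSupport.comp_left (g := fun t : ℝ => (t : ℂ)) Complex.ofReal_zero)
    (Complex.ofRealCLM.contDiff.comp P.smooth))

/-- `ψ = 𝓕⁻¹ ζ`. -/
def wavelet : 𝓢(Eu d, ℂ) :=
  invFourier (HasCompactSupport.toSchwartzMap (f := fun y => (P.ζ y : ℂ))
    (P.ζ_hasCompactSupport.comp_left (g := fun t : ℝ => (t : ℂ)) Complex.ofReal_zero)
    (Complex.ofRealCLM.contDiff.comp P.ζ_smooth))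

/-- The Zygmund norm
`‖φ * u‖_{L^∞} + sup_{0 < ε < 1} ε^{-r} ‖ψ_ε * u‖_{L^∞}`. -/
def zygmundNorm (r : ℝ) (u : 𝓢'(Eu d, ℂ)) : ℝ≥0∞ :=
  eLpNorm (conv u P.lowPass) ⊤ volume +
    ⨆ ε : Eps, ENNReal.ofReal ((ε : ℝ) ^ (-r)) *
      eLpNorm (conv u (dilate ε ε.2.1 P.wavelet)) ⊤ volume

/-- The Zygmund space `C_*^r(ℝᵈ)`. -/
def zygmund (r : ℝ) : Set 𝓢'(Eu d, ℂ) := {u | P.zygmundNorm r u < ⊤}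

end LittlewoodPaley

end Gen

end

noncomputable section

namespace Gen

variable {d : ℕ}

/-! ### Cutoff functions and the support of a compactly supported distribution -/

/-! Since all supports lie in one relatively compact set, pairings with arbitrary smooth functions
(characters, translated mollifiers) reduce to pairings with test functions. Along `epsSeq`, the zero
extensions `F j` of the net are Schwartz functions, and association says that `∫ F j * h` tends to
`T h` for every smooth `h` (`WeakLimit`). Every estimate is proved for `F j` and passed to the
limit.

When the exponent zero is attained, the derivatives of `F j` up to order `k` are bounded uniformly
in `j`. Integration by parts gives the decay of order `k` of the Fourier transforms. For the Zygmund
norm, Parseval moves `ψ_ε * F j` to frequencies of size about `1/ε`: the decay contributes `ε^k`,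
the volume of the frequency ball `ε^{-d}` (`WeakLimit.mem_zygmund`). For the embedding, `T` has
order zero, so `T * φ_ε` is smooth, and its derivatives up to order `k` are bounded because they can
be moved onto `F j` (`WeakLimit.embeddingMem`). The net then has some class `(i, h)` with `i ≥ k`,
`h ≤ 0`: a negative calibration at order zero would force `T = 0`, since `T * φ_ε` converges weakly
to `T`.

When zero is not attained, the decay estimate for `F j` loses `ε^{-a}` with `a > 0` as small as
desired. Strong association gives a rate `ε^b`, but with a constant depending on the test function.
Banach-Steinhaus turns it into a bound `ε^b (1 + |ξ|)^N` for the difference of the Fourier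
transforms (`exists_uniform_fourier_bound`). Taking `ε` to be a suitable power of `1 + |ξ|²`
balances the two errors and costs only `η` (`le_rpow_of_forall_epsSeq`). -/

theorem exists_cutoff {K V : Set (Eu d)} (hK : IsCompact K) (hV : IsOpen V) (hKV : K ⊆ V) :
    ∃ χ : Eu d → ℂ, ContDiff ℝ ∞ χ ∧ HasCompactSupport χ ∧ tsupport χ ⊆ V ∧
      ∀ᶠ x in 𝓝ˢ K, χ x = 1 := by
  obtain ⟨L, hL, hKL, hLV⟩ := exists_compact_between hK hV hKV
  obtain ⟨f, h1, h0, -⟩ := exists_contMDiffMap_one_nhds_of_subset_interior (n := ⊤)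
    (modelWithCornersSelf ℝ (Eu d)) hK.isClosed hKL
  have hsupp : tsupport (fun x => (f x : ℂ)) ⊆ L :=
    closure_minimal (fun x hx => by
      by_contra hxL
      exact hx (by simp [h0 x hxL])) hL.isClosed
  refine ⟨fun x => (f x : ℂ), Complex.ofRealCLM.contDiff.comp f.contMDiff.contDiff,
    hL.of_isClosed_subset (isClosed_tsupport _) hsupp, hsupp.trans hLV, ?_⟩
  filter_upwards [h1] with x hx
  simp [hx]

theorem contDiff_mul_of_tsupport_subset {Ω : Opens (Eu d)} {χ h : Eu d → ℂ}
    (hχ : ContDiff ℝ ∞ χ) (hχΩ : tsupport χ ⊆ Ω) (hh : h ∈ smoothOn Ω) :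
    ContDiff ℝ ∞ (fun x => χ x * h x) := by
  refine contDiff_iff_contDiffAt.2 fun x => ?_
  by_cases hx : x ∈ tsupport χ
  · exact hχ.contDiffAt.mul (ContDiffOn.contDiffAt hh (Ω.isOpen.mem_nhds (hχΩ hx)))
  · refine (contDiffAt_const (c := (0 : ℂ))).congr_of_eventuallyEq ?_
    filter_upwards [notMem_tsupport_iff_eventuallyEq.1 hx] with y hy
    simp [hy]

theorem hasCompactSupport_mul_left {χ h : Eu d → ℂ} (hχ : HasCompactSupport χ) :
    HasCompactSupport (fun x => χ x * h x) :=
  HasCompactSupport.mul_right (f := χ) (f' := h) hχ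

/-- The test function `χ h`, where `χ` is a cutoff function. -/
def cutoffMul {Ω : Opens (Eu d)} (χ : Eu d → ℂ) (hχ : ContDiff ℝ ∞ χ)
    (hc : HasCompactSupport χ) (hχΩ : tsupport χ ⊆ Ω) (h : smoothOn Ω) : 𝓓(Ω, ℂ) where
  toFun x := χ x * (h : Eu d → ℂ) x
  contDiff' := contDiff_mul_of_tsupport_subset hχ hχΩ h.2
  hasCompactSupport' := hasCompactSupport_mul_left hc
  tsupport_subset' := (tsupport_mul_subset_left).trans hχΩ

theorem cutoffMul_apply {Ω : Opens (Eu d)} (χ : Eu d → ℂ) (hχ : ContDiff ℝ ∞ χ)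
    (hc : HasCompactSupport χ) (hχΩ : tsupport χ ⊆ Ω) (h : smoothOn Ω) (x : Eu d) :
    cutoffMul χ hχ hc hχΩ h x = χ x * (h : Eu d → ℂ) x := rfl

namespace CompactDistribution

variable {Ω : Opens (Eu d)} (T : CompactDistribution Ω)

theorem pair_add (ρ σ : 𝓓(Ω, ℂ)) : T.pair (ρ + σ) = T.pair ρ + T.pair σ := by
  simp only [pair]
  rw [← map_add]
  rfl

/-- A two-piece partition of unity: with `χ = 1` near the part of the support outside `W`, the
function `χ ρ` lives in `V` and `(1 - χ) ρ` in `W`. -/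
theorem isVanishingOn_union {V W : Set (Eu d)} (hV : IsOpen V) (hW : IsOpen W)
    (h1 : Distribution.IsVanishingOn T.pair V) (h2 : Distribution.IsVanishingOn T.pair W) :
    Distribution.IsVanishingOn T.pair (V ∪ W) := by
  intro ρ hρ
  have hK : IsCompact (tsupport ρ \ W) := ρ.hasCompactSupport.isCompact.diff hW
  obtain ⟨χ, hχ, hc, hχV, h1'⟩ := exists_cutoff hK (hV.inter Ω.isOpen)
    (fun x hx => ⟨(hρ hx.1).resolve_right hx.2, ρ.tsupport_subset hx.1⟩)
  let ρ' : smoothOn Ω := ⟨ρ, testFunction_mem_smoothOn Ω ρ⟩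
  have hχΩ : tsupport χ ⊆ Ω := fun x hx => (hχV hx).2
  let ρ₁ : 𝓓(Ω, ℂ) := cutoffMul χ hχ hc hχΩ ρ'
  have hρ₁ : ∀ x, ρ₁ x = χ x * ρ x := fun x => rfl
  have hρ₁V : tsupport ρ₁ ⊆ V := 
    Set.Subset.trans (b := tsupport χ) tsupport_mul_subset_left fun x hx => (hχV hx).1
  have e : ρ = ρ₁ + (ρ - ρ₁) := by abel
  rw [e, pair_add, h1 ρ₁ hρ₁V, zero_add]
  refine h2 _ fun x hx => ?_
  by_contra hxW
  have hxρ : x ∈ tsupport ρ := by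
    refine closure_mono (fun y hy => ?_) hx
    intro hy0
    exact hy (by simp [hρ₁, hy0])
  have hx1 : ∀ᶠ y in 𝓝 x, χ y = 1 := h1'.filter_mono
    (nhds_le_nhdsSet (Set.mem_sdiff_of_mem hxρ hxW))
  refine notMem_tsupport_iff_eventuallyEq.2 ?_ hx
  filter_upwards [hx1] with y hy
  simp [hρ₁, hy]

theorem exists_isVanishingOn_of_disjoint {K : Set (Eu d)} (hK : IsCompact K)
    (hd : Disjoint K T.supp) :
    ∃ V, IsOpen V ∧ K ⊆ V ∧ Distribution.IsVanishingOn T.pair V := by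
  refine hK.induction_on
    (p := fun S => ∃ V, IsOpen V ∧ S ⊆ V ∧ Distribution.IsVanishingOn T.pair V) ?_ ?_ ?_ ?_
  · refine ⟨∅, isOpen_empty, le_rfl, fun ρ hρ => ?_⟩
    have : ρ = 0 := by
      ext x
      by_contra hx
      exact hρ (subset_tsupport _ hx)
    rw [this]
    exact T.toLinearMap.map_zero
  · rintro s t hst ⟨V, hV, htV, h⟩
    exact ⟨V, hV, hst.trans htV, h⟩
  · rintro s t ⟨V, hV, hsV, h⟩ ⟨W, hW, htW, h'⟩
    exact ⟨V ∪ W, hV.union hW, Set.union_subset_union hsV htW, T.isVanishingOn_union hV hW h h'⟩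
  · intro x hx
    obtain ⟨V, h, hV, hxV⟩ :=
      (Distribution.notMem_dsupport_iff x).1 (Set.disjoint_left.1 hd hx)
    exact ⟨V, mem_nhdsWithin_of_mem_nhds (hV.mem_nhds hxV), V, hV, le_rfl, h⟩

/-- Let `χ = 1` near the compact set `K` of the continuity estimate. Then `T` does not see `(1 -
χ)(h - h')`, which vanishes near `K`, and `χ (h - h')` is a test function supported away from
`T.supp`. -/
theorem eq_of_eventuallyEq (h h' : smoothOn Ω) {W : Set (Eu d)} (hW : IsOpen W)
    (hTW : T.supp ⊆ W) (hh : ∀ x ∈ W ∩ Ω, (h : Eu d → ℂ) x = (h' : Eu d → ℂ) x) :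
    T.toLinearMap h = T.toLinearMap h' := by
  obtain ⟨K, N, C, hK, hKΩ, hC, hT⟩ := T.continuous'
  obtain ⟨χ, hχ, hc, hχΩ, h1⟩ := exists_cutoff hK Ω.isOpen hKΩ
  let ρ : 𝓓(Ω, ℂ) := cutoffMul χ hχ hc hχΩ (h - h')
  have hρ : ∀ x, ρ x = χ x * ((h : Eu d → ℂ) x - (h' : Eu d → ℂ) x) := fun x => rfl
  have hρ0 : T.pair ρ = 0 := by
    obtain ⟨V, hV, hKV, hvan⟩ := T.exists_isVanishingOn_of_disjoint (K := tsupport ρ)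
      ρ.hasCompactSupport.isCompact (by
        refine Set.disjoint_left.2 fun x hx hxT => notMem_tsupport_iff_eventuallyEq.2 ?_ hx
        filter_upwards [hW.mem_nhds (hTW hxT), Ω.isOpen.mem_nhds (ρ.tsupport_subset hx)]
          with y hy hyΩ
        simp [hρ, hh y ⟨hy, hyΩ⟩])
    exact hvan ρ hKV
  have h2 : T.toLinearMap ((h - h') - ⟨ρ, testFunction_mem_smoothOn Ω ρ⟩) = 0 := by
    -- The continuity estimate is used with `B = 0`: all derivatives vanish on `K`.
    refine norm_le_zero_iff.1 ((hT _ 0 le_rfl fun n _ x hx => ?_).trans (by simp))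
    have : (((h - h') - ⟨ρ, testFunction_mem_smoothOn Ω ρ⟩ : smoothOn Ω) : Eu d → ℂ)
        =ᶠ[𝓝 x] 0 := by
      filter_upwards [h1.filter_mono (nhds_le_nhdsSet hx)] with y hy
      simp [hρ, hy]
    rw [(this.iteratedFDeriv ℝ n).eq_of_nhds]
    simp
  rw [map_sub, map_sub] at h2
  have h3 : T.toLinearMap ⟨ρ, testFunction_mem_smoothOn Ω ρ⟩ = 0 := hρ0
  rw [h3, sub_zero, sub_eq_zero] at h2
  exact h2

theorem exists_testFunction_eq {U : Set (Eu d)} (hU : RelCompact U Ω) (hT : T.supp ⊆ U)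
    (h : smoothOn Ω) :
    ∃ ρ : 𝓓(Ω, ℂ), T.toLinearMap h = T.pair ρ ∧ ∀ x ∈ U, ρ x = (h : Eu d → ℂ) x := by
  obtain ⟨χ, hχ, hc, hχΩ, h1⟩ := exists_cutoff hU.2.1 Ω.isOpen hU.2.2
  have h2 : ∀ x ∈ U, cutoffMul χ hχ hc hχΩ h x = (h : Eu d → ℂ) x := fun x hx => by
    rw [cutoffMul_apply, h1.self_of_nhdsSet x (subset_closure hx), one_mul]
  exact ⟨cutoffMul χ hχ hc hχΩ h,
    T.eq_of_eventuallyEq _ _ hU.1 hT fun x hx => (h2 x hx.1).symm, h2⟩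

end CompactDistribution

/-! ### Extension by zero of compactly supported smooth functions -/

theorem exists_schwartz_extension {Ω : Opens (Eu d)} {U : Set (Eu d)} (hU : RelCompact U Ω)
    (g : smoothOn Ω) (hg : supportIn Ω g ⊆ U) :
    ∃ F : 𝓢(Eu d, ℂ), (∀ x ∈ Ω, F x = (g : Eu d → ℂ) x) ∧ tsupport F ⊆ U := by
  classical
  set S : Set (Eu d) := {x | x ∈ Ω ∧ (g : Eu d → ℂ) x ≠ 0}
  -- `supportIn` is a closure relative to `Ω` only. As `S ⊆ U` and `closure U ⊆ Ω`, no limit point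
  -- of `S` escapes to the boundary of `Ω`, so the extension by zero is smooth.
  have hS : closure S ⊆ U := by
    have h1 : S ⊆ U := fun x hx => hg ⟨subset_closure hx, hx.1⟩
    exact fun x hx => hg ⟨hx, hU.2.2 (closure_mono h1 hx)⟩
  have hUΩ : U ⊆ Ω := subset_closure.trans hU.2.2
  have hsupp : Function.support ((Ω : Set (Eu d)).indicator (g : Eu d → ℂ)) = S := by
    ext x
    simp [S]
  have hts : tsupport ((Ω : Set (Eu d)).indicator (g : Eu d → ℂ)) = closure S := by
    rw [tsupport, hsupp]
  have hc : HasCompactSupport ((Ω : Set (Eu d)).indicator (g : Eu d → ℂ)) := by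
    rw [HasCompactSupport, hts]
    exact hU.2.1.of_isClosed_subset isClosed_closure (hS.trans subset_closure)
  have hsm : ContDiff ℝ ∞ ((Ω : Set (Eu d)).indicator (g : Eu d → ℂ)) := by
    refine contDiff_iff_contDiffAt.2 fun x => ?_
    by_cases hx : x ∈ Ω
    · refine (ContDiffOn.contDiffAt g.2 (Ω.isOpen.mem_nhds hx)).congr_of_eventuallyEq ?_
      filter_upwards [Ω.isOpen.mem_nhds hx] with y hy
      exact Set.indicator_of_mem hy _
    · refine (contDiffAt_const (c := (0 : ℂ))).congr_of_eventuallyEq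
        (notMem_tsupport_iff_eventuallyEq.1 fun h => hx ?_)
      rw [hts] at h
      exact hUΩ (hS h)
  refine ⟨hc.toSchwartzMap hsm, fun x hx => Set.indicator_of_mem hx _, ?_⟩
  change tsupport ((Ω : Set (Eu d)).indicator (g : Eu d → ℂ)) ⊆ U
  rw [hts]
  exact hS

theorem pairSmooth_eq_integral {Ω : Opens (Eu d)} {U : Set (Eu d)} (hU : RelCompact U Ω)
    (g : smoothOn Ω) {F : 𝓢(Eu d, ℂ)} (hF : ∀ x ∈ Ω, F x = (g : Eu d → ℂ) x)
    (hFU : tsupport F ⊆ U) (ρ : 𝓓(Ω, ℂ)) {h : Eu d → ℂ} (hρ : ∀ x ∈ U, ρ x = h x) :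
    pairSmooth g ρ = ∫ x, F x * h x := by
  have h0 : ∀ x ∉ U, F x = 0 := fun x hx => image_eq_zero_of_notMem_tsupport fun h => hx (hFU h)
  have hUΩ : U ⊆ Ω := subset_closure.trans hU.2.2
  rw [pairSmooth, ← setIntegral_eq_integral_of_forall_compl_eq_zero (s := (Ω : Set (Eu d)))
    (f := fun x => F x * h x) (fun x hx => by rw [h0 x fun h => hx (hUΩ h), zero_mul])]
  refine setIntegral_congr_fun Ω.isOpen.measurableSet fun x hx => ?_
  by_cases hxU : x ∈ U
  · simp [hF x hx, hρ x hxU]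
  · simp [← hF x hx, h0 x hxU]

/-! ### A sequence of parameters tending to zero -/

/-- The sequence of parameters `2^{-(j+1)}`. -/
def epsSeq (j : ℕ) : Eps :=
  ⟨(1 / 2) ^ (j + 1), by positivity, pow_lt_one₀ (by norm_num) (by norm_num) (by omega)⟩

theorem epsSeq_coe (j : ℕ) : (epsSeq j : ℝ) = (1 / 2) ^ (j + 1) := rfl

theorem tendsto_epsSeq_coe : Tendsto (fun j => (epsSeq j : ℝ)) atTop (𝓝 0) :=
  (tendsto_pow_atTop_nhds_zero_of_lt_one (by norm_num) (by norm_num)).comp (tendsto_add_atTop_nat 1)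

theorem tendsto_epsSeq : Tendsto epsSeq atTop epsZero :=
  tendsto_comap_iff.2 tendsto_epsSeq_coe

/-! ### Bounds for derivatives from calibrations -/

theorem exponents_mono {Ω : Opens (Eu d)} {U : Set (Eu d)} {m : ℕ} {g : Net Ω} {a b : ℝ}
    (ha : a ∈ exponents U m g) (hab : a ≤ b) : b ∈ exponents U m g :=
  ha.mono fun ε => by
    gcongr ?_ * _
    exact ENNReal.ofReal_le_ofReal (Real.rpow_le_rpow_of_exponent_ge ε.2.1 ε.2.2.le hab)

theorem exists_mem_exponents_of_calibration_lt {Ω : Opens (Eu d)} {U : Set (Eu d)} {m : ℕ}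
    {g : Net Ω} {s : ℝ} (h : calibration U m g < s) : s ∈ exponents U m g := by
  obtain ⟨_, ⟨a, ha, rfl⟩, has⟩ := sInf_lt_iff.1 h
  exact exponents_mono ha (EReal.coe_lt_coe_iff.1 has).le

theorem calibration_le_of_mem {Ω : Opens (Eu d)} {U : Set (Eu d)} {m : ℕ}
    {g : Net Ω} {s : ℝ} (h : s ∈ exponents U m g) : calibration U m g ≤ s :=
  sInf_le ⟨s, h, rfl⟩

theorem IsBigOPow.finite_iSup {ι : Type*} [Finite ι] {N : ι → Eps → ℝ≥0∞} {b : ℝ}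
    (h : ∀ i, IsBigOPow (N i) b) : IsBigOPow (fun ε => ⨆ i, N i ε) b := by
  cases nonempty_fintype ι
  choose C hC using h
  refine ⟨∑ i, C i, ?_⟩
  filter_upwards [eventually_all.2 hC] with ε hε
  refine iSup_le fun i => (hε i).trans ?_
  gcongr
  exact Finset.single_le_sum (f := C) (fun _ _ => zero_le) (Finset.mem_univ i)

theorem partialNorm_le_sobolevNorm {n m : ℕ} (hn : n ≤ m) (i : Fin n → Fin d) (U : Set (Eu d))
    (f : Eu d → ℂ) : partialNorm i U f ≤ sobolevNorm m U f :=
  le_iSup_of_le n (le_iSup_of_le hn (le_iSup (fun i => partialNorm i U f) i))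

theorem sobolevNorm_eq_iSup (m : ℕ) (U : Set (Eu d)) (f : Eu d → ℂ) :
    sobolevNorm m U f = ⨆ p : (Σ n : Fin (m + 1), (Fin n → Fin d)), partialNorm p.2 U f := by
  refine le_antisymm (iSup_le fun n => iSup_le fun hn => iSup_le fun i => ?_) ?_
  · exact le_iSup (fun p : (Σ n : Fin (m + 1), (Fin n → Fin d)) => partialNorm p.2 U f)
      ⟨⟨n, Nat.lt_succ_of_le hn⟩, i⟩
  · refine iSup_le fun p => ?_
    exact le_iSup_of_le (p.1 : ℕ) (le_iSup_of_le (Nat.le_of_lt_succ p.1.2)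
      (le_iSup (fun i => partialNorm i U f) p.2))

/-- A strictly negative class leaves room for the exponent zero to be attained. In class `∞` the
bounds hold for each derivative separately, and only finitely many derivatives have order at most
`k`. -/
theorem zero_mem_exponents_of_moderateClass_neg {Ω : Opens (Eu d)} {U : Set (Eu d)}
    (hU : RelCompact U Ω) {k : ℕ} {g : Net Ω} {s : ℝ} (hs : s < 0)
    (hg : g ∈ moderateClass Ω (k : ℕ∞) (s : EReal)) : (0 : ℝ) ∈ exponents U k g := by
  obtain ⟨-, i, hki, h, hhs, hclass⟩ := hg
  have hh0 : h < ((0 : ℝ) : EReal) := hhs.trans_lt (EReal.coe_lt_coe_iff.2 hs)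
  induction i using WithTop.recTopCoe with
  | top =>
    obtain ⟨-, rfl⟩ := hclass
    obtain ⟨_, ⟨a, ha, rfl⟩, ha0⟩ := sInf_lt_iff.1 hh0
    refine exponents_mono (a := a) ?_ (EReal.coe_lt_coe_iff.1 ha0).le
    have := IsBigOPow.finite_iSup
      (fun p : (Σ n : Fin (k + 1), (Fin n → Fin d)) => ha U hU p.1 p.2)
    simpa only [exponents, Set.mem_ofPred_eq, sobolevNorm_eq_iSup, ENNReal.mul_iSup] using this
  | coe i =>
    obtain ⟨-, ⟨hgr, -⟩, -⟩ := hclass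
    have hki' : k ≤ i := Nat.cast_le.1 hki
    exact exists_mem_exponents_of_calibration_lt ((hgr U hU k hki').trans_lt hh0)

theorem schwartz_partialD {n : ℕ} (i : Fin n → Fin d) (F : 𝓢(Eu d, ℂ)) (x : Eu d) :
    partialD i F x =
      LineDeriv.iteratedLineDerivOp (fun j => EuclideanSpace.single (i j) (1 : ℝ)) F x :=
  SchwartzMap.iteratedLineDerivOp_eq_iteratedFDeriv.symm

/-- By continuity, a violation at one point persists on a nonempty open set, which has positive
measure. -/
theorem norm_le_of_eLpNorm_top_le {U : Set (Eu d)} (hU : IsOpen U) {v : Eu d → ℂ}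
    (hv : ContinuousOn v U) {B : ℝ} (hB : 0 ≤ B)
    (h : eLpNorm v ⊤ (volume.restrict U) ≤ ENNReal.ofReal B) {x : Eu d} (hx : x ∈ U) :
    ‖v x‖ ≤ B := by
  by_contra hlt
  push Not at hlt
  obtain ⟨V, hVU, hV, hxV⟩ : ∃ V ⊆ U, IsOpen V ∧ (x ∈ V ∧ ∀ y ∈ V, B < ‖v y‖) := by
    refine ⟨U ∩ (fun y => ‖v y‖) ⁻¹' Set.Ioi B, Set.inter_subset_left,
      hv.norm.isOpen_inter_preimage hU isOpen_Ioi, ⟨hx, hlt⟩, fun y hy => hy.2⟩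
  have h0 : ∀ᵐ y ∂volume.restrict U, ‖v y‖ ≤ B := by
    filter_upwards [ae_le_eLpNormEssSup (f := v) (μ := volume.restrict U)] with y hy
    rw [eLpNorm_exponent_top] at h
    have := hy.trans h
    rwa [← ofReal_norm, ENNReal.ofReal_le_ofReal_iff hB] at this
  rw [ae_restrict_iff' hU.measurableSet, ae_iff] at h0
  have h1 : volume V = 0 := measure_mono_null (fun y hy => by
    simp only [Set.mem_ofPred_eq, not_forall, not_le]
    exact ⟨hVU hy, hxV.2 y hy⟩) h0
  exact (hV.measure_pos volume ⟨x, hxV.1⟩).ne' h1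

theorem norm_partialD_le_of_sobolevNorm_le {Ω : Opens (Eu d)} {U : Set (Eu d)}
    (hU : RelCompact U Ω) (g : smoothOn Ω) {F : 𝓢(Eu d, ℂ)}
    (hF : ∀ x ∈ Ω, F x = (g : Eu d → ℂ) x) (hFU : tsupport F ⊆ U) {k : ℕ} {B : ℝ} (hB : 0 ≤ B)
    (h : sobolevNorm k U g ≤ ENNReal.ofReal B) {n : ℕ} (hn : n ≤ k) (i : Fin n → Fin d)
    (x : Eu d) : ‖partialD i F x‖ ≤ B := by
  have hUΩ : U ⊆ Ω := subset_closure.trans hU.2.2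
  by_cases hx : x ∈ U
  · refine norm_le_of_eLpNorm_top_le hU.1 (v := partialD i F) ?_ hB ?_ hx
    · have : partialD i F = LineDeriv.iteratedLineDerivOp
          (fun j => EuclideanSpace.single (i j) (1 : ℝ)) F :=
        funext fun x => schwartz_partialD i F x
      rw [this]
      exact (SchwartzMap.continuous _).continuousOn
    · have he : partialD i F =ᵐ[volume.restrict U] partialD i g := by
        refine (ae_restrict_iff' hU.1.measurableSet).2 (Eventually.of_forall fun y hy => ?_)
        have : F =ᶠ[𝓝 y] (g : Eu d → ℂ) := by
          filter_upwards [Ω.isOpen.mem_nhds (hUΩ hy)] with z hz using hF z hz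
        rw [partialD, partialD, (this.iteratedFDeriv ℝ n).eq_of_nhds]
      rw [eLpNorm_congr_ae he]
      exact (partialNorm_le_sobolevNorm hn i U g).trans h
  · have : (F : Eu d → ℂ) =ᶠ[𝓝 x] 0 :=
      notMem_tsupport_iff_eventuallyEq.1 fun h => hx (hFU h)
    rw [partialD, (this.iteratedFDeriv ℝ n).eq_of_nhds]
    simpa using hB

theorem schwartz_exists_partialD_bound (F : 𝓢(Eu d, ℂ)) (k : ℕ) :
    ∃ B : ℝ, 0 ≤ B ∧ ∀ n ≤ k, ∀ (i : Fin n → Fin d) (x : Eu d), ‖partialD i F x‖ ≤ B := by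
  refine ⟨∑ n ∈ Finset.range (k + 1), SchwartzMap.seminorm ℝ 0 n F,
    Finset.sum_nonneg fun n _ => apply_nonneg _ _, fun n hn i x => ?_⟩
  have h1 := SchwartzMap.norm_iteratedFDeriv_le_seminorm ℝ F n x
  have h2 : ‖partialD i F x‖ ≤ ‖iteratedFDeriv ℝ n F x‖ := by
    refine ((iteratedFDeriv ℝ n F x).le_opNorm _).trans ?_
    simp
  exact (h2.trans h1).trans (Finset.single_le_sum (f := fun n => SchwartzMap.seminorm ℝ 0 n F)
    (fun n _ => apply_nonneg _ _) (Finset.mem_range.2 (Nat.lt_succ_of_le hn)))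

theorem exists_bound_of_eventually {u v : ℕ → ℝ} {C : ℝ} (hv : ∀ j, 0 < v j)
    (h : ∀ᶠ j in atTop, u j ≤ C * v j) : ∃ M : ℝ, 0 ≤ M ∧ ∀ j, u j ≤ M * v j := by
  obtain ⟨J, hJ⟩ := eventually_atTop.1 h
  have hs : ∀ j, 0 ≤ |u j| / v j := fun j => div_nonneg (abs_nonneg _) (hv j).le
  have h0 : 0 ≤ ∑ j ∈ Finset.range J, |u j| / v j := Finset.sum_nonneg fun j _ => hs j
  refine ⟨|C| + ∑ j ∈ Finset.range J, |u j| / v j, by positivity, fun j => ?_⟩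
  rw [← div_le_iff₀ (hv j)]
  rcases le_or_gt J j with hj | hj
  · have := (div_le_iff₀ (hv j)).2 (hJ j hj)
    linarith [le_abs_self C]
  · have h1 := Finset.single_le_sum (f := fun j => |u j| / v j) (fun j _ => hs j)
      (Finset.mem_range.2 hj)
    have h2 : u j / v j ≤ |u j| / v j := div_le_div_of_nonneg_right (le_abs_self _) (hv j).le
    linarith [abs_nonneg C]

theorem exists_partialD_bound {Ω : Opens (Eu d)} {U : Set (Eu d)} (hU : RelCompact U Ω)
    {f : Net Ω} {F : ℕ → 𝓢(Eu d, ℂ)}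
    (hF : ∀ j, ∀ x ∈ Ω, F j x = (f (epsSeq j) : Eu d → ℂ) x) (hFU : ∀ j, tsupport (F j) ⊆ U)
    {k : ℕ} {a : ℝ} (ha : a ∈ exponents U k f) :
    ∃ M : ℝ, 0 ≤ M ∧ ∀ j, ∀ n ≤ k, ∀ (i : Fin n → Fin d) (x : Eu d),
      ‖partialD i (F j) x‖ ≤ M * (epsSeq j : ℝ) ^ (-a) := by
  obtain ⟨C, hC⟩ := ha
  have hpos : ∀ j, 0 < (epsSeq j : ℝ) ^ (-a) := fun j => Real.rpow_pos_of_pos (epsSeq j).2.1 _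
  choose B hB0 hB using fun j => schwartz_exists_partialD_bound (F j) k
  -- The calibration bound holds only eventually; the finitely many remaining `j` fall back on the
  -- crude bound `B j`, which is then absorbed into `M`.
  let u : ℕ → ℝ := fun j => if sobolevNorm k U (f (epsSeq j)) ≤
    ENNReal.ofReal (C * (epsSeq j : ℝ) ^ (-a)) then C * (epsSeq j : ℝ) ^ (-a) else B j
  obtain ⟨M, hM0, hM⟩ : ∃ M : ℝ, 0 ≤ M ∧ ∀ j, u j ≤ M * (epsSeq j : ℝ) ^ (-a) := by
    refine exists_bound_of_eventually (C := C) hpos ?_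
    filter_upwards [tendsto_epsSeq.eventually hC] with j hj
    have hp : 0 < (epsSeq j : ℝ) ^ a := Real.rpow_pos_of_pos (epsSeq j).2.1 _
    have : sobolevNorm k U (f (epsSeq j)) ≤ ENNReal.ofReal (C * (epsSeq j : ℝ) ^ (-a)) := by
      rw [Real.rpow_neg (epsSeq j).2.1.le, ← div_eq_mul_inv, ENNReal.ofReal_div_of_pos hp,
        ENNReal.le_div_iff_mul_le (Or.inl (by simpa using hp)) (Or.inl ENNReal.ofReal_ne_top),
        mul_comm]
      simpa using hj
    simp only [u, if_pos this, le_refl]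
  refine ⟨M, hM0, fun j n hn i x => le_trans ?_ (hM j)⟩
  by_cases h : sobolevNorm k U (f (epsSeq j)) ≤ ENNReal.ofReal (C * (epsSeq j : ℝ) ^ (-a))
  · simp only [u, if_pos h]
    exact norm_partialD_le_of_sobolevNorm_le hU (f (epsSeq j)) (hF j) (hFU j)
      (mul_nonneg C.2 (hpos j).le) h hn i x
  · simp only [u, if_neg h]
    exact hB j n hn i x

/-! ### Decay of Fourier transforms -/

/-- The dictionary between the two normalizations: Mathlib's frequency `w` corresponds to `ξ = 2π
w`. -/
theorem integral_mul_character (F : 𝓢(Eu d, ℂ)) (w : Eu d) :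
    ∫ x, F x * character ((2 * Real.pi) • w) x = 𝓕 F w := by
  rw [SchwartzMap.fourier_coe, Real.fourier_eq']
  refine integral_congr_ae (Eventually.of_forall fun x => ?_)
  simp only [character, smul_eq_mul, inner_smul_right]
  rw [mul_comm]
  congr 2
  push_cast
  ring

theorem norm_fourier_le_of_bound {U : Set (Eu d)} (hUv : volume U ≠ ⊤) {G : 𝓢(Eu d, ℂ)}
    (hG : ∀ x ∉ U, G x = 0) {M : ℝ} (hM : ∀ x, ‖G x‖ ≤ M) (w : Eu d) :
    ‖𝓕 G w‖ ≤ M * volume.real U := by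
  rw [SchwartzMap.fourier_coe]
  refine (VectorFourier.norm_fourierIntegral_le_integral_norm _ _ _ _ w).trans ?_
  rw [← setIntegral_eq_integral_of_forall_compl_eq_zero (s := U)
    (f := fun x => ‖G x‖) (fun x hx => by rw [hG x hx, norm_zero])]
  refine (le_abs_self _).trans ?_
  refine norm_setIntegral_le_of_norm_le_const (f := fun x => ‖G x‖) hUv.lt_top fun x _ => ?_
  simpa using hM x

theorem fourier_iterated_lineDeriv (F : 𝓢(Eu d, ℂ)) (v : Eu d) (n : ℕ) (w : Eu d) :
    𝓕 (LineDeriv.iteratedLineDerivOp (fun _ : Fin n => v) F) w =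
      (2 * Real.pi * Complex.I * (inner ℝ w v : ℝ)) ^ n * 𝓕 F w := by
  rw [LineDeriv.iteratedLineDerivOp_const_eq_iter_lineDerivOp]
  induction n with
  | zero => simp
  | succ n ih =>
    have hg : (inner ℝ · v : Eu d → ℝ).HasTemperateGrowth :=
      ((innerSL ℝ).flip v).hasTemperateGrowth
    rw [Function.iterate_succ_apply', SchwartzMap.fourier_lineDerivOp_eq]
    simp only [_root_.smul_apply, SchwartzMap.smulLeftCLM_apply_apply hg, ih, pow_succ,
      smul_eq_mul, Complex.real_smul]
    ring

/-- For `‖x‖ ≤ 1` the weight is bounded. Otherwise some coordinate satisfies `‖x‖² ≤ d |x i|²`, so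
pure powers of the coordinates control the weight and only pure derivatives `∂_i^k` are needed. -/
theorem one_add_norm_sq_rpow_le (x : Eu d) (k : ℕ) {c A : ℝ} (hA : 0 ≤ A) (h0 : A ≤ c)
    (hk : ∀ i, |x i| ^ k * A ≤ c) :
    A ≤ (2 + 2 * d : ℝ) ^ ((k : ℝ) / 2) * c * (1 + ‖x‖ ^ 2) ^ (-(k : ℝ) / 2) := by
  have h1 : 0 < 1 + ‖x‖ ^ 2 := by positivity
  rw [neg_div, Real.rpow_neg h1.le, ← div_eq_mul_inv, le_div_iff₀ (Real.rpow_pos_of_pos h1 _)]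
  have hc : 0 ≤ c := hA.trans h0
  rcases le_or_gt (‖x‖ ^ 2) 1 with hx | hx
  · rw [mul_comm]
    gcongr ?_ * ?_
    exact Real.rpow_le_rpow h1.le (by linarith [Nat.cast_nonneg (α := ℝ) d]) (by positivity)
  · obtain ⟨i, hi⟩ : ∃ i, ‖x‖ ^ 2 ≤ d * |x i| ^ 2 := by
      by_contra hcon
      push Not at hcon
      have h2 : ∑ i : Fin d, (d : ℝ) * |x i| ^ 2 ≤ ∑ i : Fin d, ‖x‖ ^ 2 :=
        Finset.sum_le_sum fun i _ => (hcon i).le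
      rcases Nat.eq_zero_or_pos d with rfl | hd
      · rw [EuclideanSpace.norm_sq_eq] at hx
        simp at hx
        linarith
      · have h3 : ∑ i : Fin d, (d : ℝ) * |x i| ^ 2 < ∑ i : Fin d, ‖x‖ ^ 2 :=
          Finset.sum_lt_sum_of_nonempty ⟨⟨0, hd⟩, Finset.mem_univ _⟩ fun i _ => hcon i
        rw [← Finset.mul_sum, Finset.sum_const, EuclideanSpace.norm_sq_eq] at h3
        simp at h3
    have h2 : 1 + ‖x‖ ^ 2 ≤ (2 + 2 * d) * |x i| ^ 2 := by nlinarith [sq_nonneg |x i|]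
    have h3 : (1 + ‖x‖ ^ 2) ^ ((k : ℝ) / 2) ≤ (2 + 2 * d : ℝ) ^ ((k : ℝ) / 2) * |x i| ^ k := by
      calc (1 + ‖x‖ ^ 2) ^ ((k : ℝ) / 2) ≤ ((2 + 2 * d) * |x i| ^ 2) ^ ((k : ℝ) / 2) := by gcongr
        _ = _ := by
          rw [Real.mul_rpow (by positivity) (by positivity), ← Real.rpow_natCast_mul (abs_nonneg _)]
          congr 1
          rw [← Real.rpow_natCast]
          congr 1
          push_cast
          ring
    calc A * (1 + ‖x‖ ^ 2) ^ ((k : ℝ) / 2)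
        ≤ A * ((2 + 2 * d : ℝ) ^ ((k : ℝ) / 2) * |x i| ^ k) := by gcongr
      _ = (2 + 2 * d : ℝ) ^ ((k : ℝ) / 2) * (|x i| ^ k * A) := by ring
      _ ≤ _ := by gcongr; exact hk i

theorem norm_fourier_le_of_partialD_bound {U : Set (Eu d)}
    (hUv : volume U ≠ ⊤) {F : 𝓢(Eu d, ℂ)} (hF : tsupport F ⊆ U) {k : ℕ} {M : ℝ}
    (hM : ∀ n ≤ k, ∀ (i : Fin n → Fin d) (x : Eu d), ‖partialD i F x‖ ≤ M) (w : Eu d) :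
    ‖𝓕 F w‖ ≤ (2 + 2 * d : ℝ) ^ ((k : ℝ) / 2) * (M * volume.real U) *
      (1 + ‖(2 * Real.pi) • w‖ ^ 2) ^ (-(k : ℝ) / 2) := by
  have key : ∀ n ≤ k, ∀ i : Fin d, |((2 * Real.pi) • w) i| ^ n * ‖𝓕 F w‖ ≤ M * volume.real U := by
    intro n hn i
    have h := norm_fourier_le_of_bound hUv (G := LineDeriv.iteratedLineDerivOp
      (fun _ : Fin n => EuclideanSpace.single i (1 : ℝ)) F) (M := M) (fun x hx => ?_)
      (fun x => ?_) w
    · rw [fourier_iterated_lineDeriv, norm_mul, norm_pow] at h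
      simpa [abs_mul, EuclideanSpace.inner_single_right] using h
    · exact image_eq_zero_of_notMem_tsupport fun h =>
        hx (hF (SchwartzMap.tsupport_iteratedLineDerivOp_subset _ F h))
    · rw [← schwartz_partialD (fun _ => i) F x]
      exact hM n hn (fun _ => i) x
  refine one_add_norm_sq_rpow_le _ k (norm_nonneg _) ?_ (key k le_rfl)
  refine norm_fourier_le_of_bound hUv (fun x hx => image_eq_zero_of_notMem_tsupport
    fun h => hx (hF h)) (fun x => ?_) w
  simpa [partialD] using hM 0 (Nat.zero_le k) Fin.elim0 x

/-! ### Convolutions and Fourier transforms -/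

theorem dilate_dilate {a b : ℝ} (ha : 0 < a) (hb : 0 < b) (φ : 𝓢(Eu d, ℂ)) :
    dilate a ha (dilate b hb φ) = dilate (a * b) (mul_pos ha hb) φ := by
  ext x
  simp only [dilate_apply, smul_smul, mul_inv_rev]
  push_cast
  rw [mul_pow, mul_inv]
  ring

theorem integral_dilate_smul {c : ℝ} (hc : 0 < c) (φ : 𝓢(Eu d, ℂ)) (h : Eu d → ℂ) :
    ∫ y, h y * dilate c hc φ y = ∫ y, h (c • y) * φ y := by
  have h1 := Measure.integral_comp_smul (μ := (volume : Measure (Eu d)))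
    (fun y => h y * dilate c hc φ y) c
  simp only [dilate_apply, inv_smul_smul₀ hc.ne', finrank_euclideanSpace, Fintype.card_fin] at h1
  have hcd : (c : ℂ) ^ d ≠ 0 := pow_ne_zero _ (by exact_mod_cast hc.ne')
  have h2 : ∫ y, h (c • y) * (((c : ℂ) ^ d)⁻¹ * φ y) =
      ((c : ℂ) ^ d)⁻¹ * ∫ y, h (c • y) * φ y := by
    rw [← integral_const_mul]
    exact integral_congr_ae (Eventually.of_forall fun y => by simp only; ring)
  rw [h2, abs_of_pos (by positivity), Complex.real_smul] at h1
  push_cast at h1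
  exact (mul_left_cancel₀ (inv_ne_zero hcd) h1).symm

/-- Translation contributes a unimodular phase, and dilation by `c` becomes dilation by `1/c` in
frequency. -/
theorem norm_fourierInv_reflectAt {c : ℝ} (hc : 0 < c) (Z : 𝓢(Eu d, ℂ)) (x w : Eu d) :
    ‖𝓕⁻ (reflectAt (dilate c hc (𝓕⁻ Z)) x) w‖ = ‖Z (c • w)‖ := by
  have h1 : 𝓕⁻ (reflectAt (dilate c hc (𝓕⁻ Z)) x) w =
      Complex.exp (((2 * Real.pi * inner ℝ x w : ℝ) : ℂ) * Complex.I) * Z (c • w) := by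
    have hZ : Z (c • w) = 𝓕 (𝓕⁻ Z) (c • w) := by rw [FourierTransform.fourier_fourierInv_eq]
    rw [hZ, SchwartzMap.fourierInv_coe, SchwartzMap.fourier_coe (𝓕⁻ Z), Real.fourier_eq',
      Real.fourierInv_eq', ← integral_sub_left_eq_self _ _ x]
    simp only [reflectAt_apply, sub_sub_cancel, smul_eq_mul]
    rw [integral_dilate_smul hc _ (fun y => Complex.exp (((2 * Real.pi * inner ℝ (x - y) w : ℝ) : ℂ)
      * Complex.I)), ← integral_const_mul]
    refine integral_congr_ae (Eventually.of_forall fun y => ?_)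
    simp only
    rw [← mul_assoc, ← Complex.exp_add]
    congr 2
    simp only [inner_sub_left, inner_smul_left, inner_smul_right]
    push_cast
    simp
    ring
  rw [h1, norm_mul, Complex.norm_exp_ofReal_mul_I, one_mul]

/-- Parseval's formula, followed by the sup bound on a frequency ball of radius `ρ`. The volume
factor `ρ ^ d` is the source of the loss of `d` in the Zygmund exponent. -/
theorem norm_integral_mul_reflectAt_le {c : ℝ} (hc : 0 < c) (F Z : 𝓢(Eu d, ℂ)) (x : Eu d)
    {A m ρ : ℝ} (hA : 0 ≤ A) (hρ : 0 ≤ ρ) (hm : ∀ y, ‖Z y‖ ≤ m)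
    (h : ∀ w, Z (c • w) ≠ 0 → ‖w‖ ≤ ρ ∧ ‖𝓕 F w‖ ≤ A) :
    ‖∫ y, F y * reflectAt (dilate c hc (𝓕⁻ Z)) x y‖ ≤
      A * m * (ρ ^ d * volume.real (Metric.ball (0 : Eu d) 1)) := by
  set G := 𝓕⁻ (reflectAt (dilate c hc (𝓕⁻ Z)) x) with hG
  have h1 : ∫ y, F y * reflectAt (dilate c hc (𝓕⁻ Z)) x y = ∫ w, 𝓕 F w * G w := by
    rw [SchwartzMap.integral_fourier_mul_eq, hG, FourierTransform.fourier_fourierInv_eq]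
  have hm0 : 0 ≤ m := (norm_nonneg _).trans (hm 0)
  have h2 : ∀ w, Z (c • w) = 0 → 𝓕 F w * G w = 0 := fun w hw => by
    have : ‖G w‖ = 0 := by rw [hG, norm_fourierInv_reflectAt, hw, norm_zero]
    rw [norm_eq_zero.1 this, mul_zero]
  rw [h1, ← setIntegral_eq_integral_of_forall_compl_eq_zero (s := Metric.closedBall 0 ρ)
    (fun w hw => h2 w (by
      by_contra h0
      exact hw (mem_closedBall_zero_iff.2 (h w h0).1)))]
  have h3 : volume.real (Metric.closedBall (0 : Eu d) ρ) =
      ρ ^ d * volume.real (Metric.ball (0 : Eu d) 1) := by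
    have := Measure.addHaar_real_closedBall (μ := (volume : Measure (Eu d))) 0 hρ
    simpa using this
  rw [← h3]
  refine norm_setIntegral_le_of_norm_le_const (isCompact_closedBall _ _).measure_lt_top
    fun w _ => ?_
  by_cases hw : Z (c • w) = 0
  · rw [h2 w hw, norm_zero]
    positivity
  · rw [norm_mul, hG, norm_fourierInv_reflectAt]
    exact mul_le_mul (h w hw).2 (hm _) (norm_nonneg _) hA

/-! ### Membership in Zygmund spaces -/

theorem rpow_le_add_of_mem_Icc {a b x p : ℝ} (ha : 0 < a) (hax : a ≤ x) (hxb : x ≤ b) :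
    x ^ p ≤ a ^ p + b ^ p := by
  have hb : 0 ≤ b := ha.le.trans (hax.trans hxb)
  rcases le_total 0 p with hp | hp
  · have := Real.rpow_le_rpow (ha.le.trans hax) hxb hp
    linarith [Real.rpow_nonneg ha.le p]
  · have := Real.rpow_le_rpow_of_nonpos ha hax hp
    linarith [Real.rpow_nonneg hb p]

/-- On the annulus `1/2 ≤ ε s ≤ 1` the quantity `1 + s²` lies between `ε⁻²/4` and `2 ε⁻²`; summing
the two endpoint values covers both signs of `r`. -/
theorem one_add_sq_rpow_le {ε s : ℝ} (hε : 0 < ε) (hε1 : ε < 1) (h1 : 1 / 2 ≤ ε * s)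
    (h2 : ε * s ≤ 1) (r : ℝ) :
    (1 + s ^ 2) ^ (-r / 2) ≤ ((1 / 4) ^ (-r / 2) + 2 ^ (-r / 2)) * ε ^ r := by
  have e : ε ^ r = (ε⁻¹ ^ 2) ^ (-r / 2) := by
    rw [← Real.rpow_natCast_mul (by positivity), Real.inv_rpow hε.le, ← Real.rpow_neg hε.le]
    congr 1
    push_cast
    ring
  have hs : (ε * s) ^ 2 * ε⁻¹ ^ 2 = s ^ 2 := by field_simp
  have he : 1 ≤ ε⁻¹ ^ 2 := one_le_pow₀ ((one_le_inv₀ hε).2 hε1.le)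
  rw [e, add_mul, ← Real.mul_rpow (by norm_num) (by positivity),
    ← Real.mul_rpow (by norm_num) (by positivity)]
  refine rpow_le_add_of_mem_Icc (by positivity) ?_ ?_
  · rw [← hs]
    have : 1 / 4 ≤ (ε * s) ^ 2 := by nlinarith
    nlinarith
  · rw [← hs]
    have : (ε * s) ^ 2 ≤ 1 := by nlinarith
    nlinarith

namespace LittlewoodPaley

variable (P : LittlewoodPaley d)

theorem norm_le_one_of_θ_ne_zero {y : Eu d} (hy : P.θ y ≠ 0) : ‖y‖ ≤ 1 :=
  mem_closedBall_zero_iff.1 (P.support (subset_tsupport _ hy))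

theorem norm_mem_of_ζ_ne_zero {y : Eu d} (hy : P.ζ y ≠ 0) : 1 / 2 ≤ ‖y‖ ∧ ‖y‖ ≤ 1 := by
  constructor
  · by_contra hlt
    push Not at hlt
    refine hy ?_
    have : P.θ =ᶠ[𝓝 y] fun _ => 1 := by
      filter_upwards [continuous_norm.continuousAt.eventually (gt_mem_nhds hlt)] with z hz
      exact P.eq_one z hz.le
    simp [ζ, this.fderiv_eq]
  · refine mem_closedBall_zero_iff.1 (P.support (support_fderiv_subset ℝ fun h => hy ?_))
    simp [ζ, h]

end LittlewoodPaley

/-- The smooth functions `F j` converge to `T` as functionals on `𝓔(Ω)`. -/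
def WeakLimit {Ω : Opens (Eu d)} (T : CompactDistribution Ω) (F : ℕ → 𝓢(Eu d, ℂ)) : Prop :=
  ∀ h : smoothOn Ω, Tendsto (fun j => ∫ x, F j x * (h : Eu d → ℂ) x) atTop (𝓝 (T.toLinearMap h))

theorem WeakLimit.tendsto_conv {Ω : Opens (Eu d)} {T : CompactDistribution Ω} {F : ℕ → 𝓢(Eu d, ℂ)}
    (hTF : WeakLimit T F) (φ : 𝓢(Eu d, ℂ)) (x : Eu d) :
    Tendsto (fun j => ∫ y, F j y * reflectAt φ x y) atTop (𝓝 (conv T.toTempered φ x)) :=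
  hTF ⟨reflectAt φ x, schwartz_mem_smoothOn Ω _⟩

theorem WeakLimit.tendsto_fourier {Ω : Opens (Eu d)} {T : CompactDistribution Ω}
    {F : ℕ → 𝓢(Eu d, ℂ)}
    (hTF : WeakLimit T F) (w : Eu d) :
    Tendsto (fun j => 𝓕 (F j) w) atTop (𝓝 (T.fourier ((2 * Real.pi) • w))) := by
  simp_rw [← integral_mul_character]
  exact hTF ⟨character ((2 * Real.pi) • w), character_mem_smoothOn Ω _⟩

theorem WeakLimit.norm_conv_le {Ω : Opens (Eu d)} {T : CompactDistribution Ω}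
    {F : ℕ → 𝓢(Eu d, ℂ)} (hTF : WeakLimit T F) {c : ℝ} (hc : 0 < c) (Z : 𝓢(Eu d, ℂ)) (x : Eu d)
    {A m ρ : ℝ} {κ : ℕ → ℝ} (hκ : Tendsto κ atTop (𝓝 0)) (hA : 0 ≤ A) (hκ0 : ∀ j, 0 ≤ κ j)
    (hρ : 0 ≤ ρ) (hm : ∀ y, ‖Z y‖ ≤ m)
    (h : ∀ w, Z (c • w) ≠ 0 → ‖w‖ ≤ ρ ∧ ∀ j, ‖𝓕 (F j) w‖ ≤ A + κ j) :
    ‖conv T.toTempered (dilate c hc (𝓕⁻ Z)) x‖ ≤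
      A * m * (ρ ^ d * volume.real (Metric.ball (0 : Eu d) 1)) := by
  have h1 : Tendsto (fun j => (A + κ j) * m * (ρ ^ d * volume.real (Metric.ball (0 : Eu d) 1)))
      atTop (𝓝 (A * m * (ρ ^ d * volume.real (Metric.ball (0 : Eu d) 1)))) := by
    have := ((hκ.const_add A).mul_const m).mul_const
      (ρ ^ d * volume.real (Metric.ball (0 : Eu d) 1))
    simpa using this
  refine le_of_tendsto_of_tendsto' (hTF.tendsto_conv _ x).norm h1 fun j => ?_
  exact norm_integral_mul_reflectAt_le hc (F j) Z x (add_nonneg hA (hκ0 j)) hρ hm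
    fun w hw => ⟨(h w hw).1, (h w hw).2 j⟩

theorem WeakLimit.norm_fourier_le {Ω : Opens (Eu d)} {T : CompactDistribution Ω}
    {F : ℕ → 𝓢(Eu d, ℂ)} (hTF : WeakLimit T F) {B : Eu d → ℝ} 
    (h : ∀ j w, ‖𝓕 (F j) w‖ ≤ B ((2 * Real.pi) • w)) (ξ : Eu d) : ‖T.fourier ξ‖ ≤ B ξ := by
  have hξ : (2 * Real.pi) • ((2 * Real.pi)⁻¹ • ξ) = ξ := smul_inv_smul₀ Real.two_pi_pos.ne' ξ
  have h1 := (hTF.tendsto_fourier ((2 * Real.pi)⁻¹ • ξ)).norm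
  rw [hξ] at h1
  refine le_of_tendsto' h1 fun j => ?_
  have := h j ((2 * Real.pi)⁻¹ • ξ)
  rwa [hξ] at this

/-- The error `κ j` may grow polynomially in frequency: each convolution sees only a bounded set of
frequencies, so for fixed `ε` the error disappears as `j → ∞`. -/
theorem WeakLimit.mem_zygmund {Ω : Opens (Eu d)} {T : CompactDistribution Ω}
    {F : ℕ → 𝓢(Eu d, ℂ)} (hTF : WeakLimit T F) (P : LittlewoodPaley d) {r C : ℝ} (hC : 0 ≤ C)
    {N : ℕ} {κ : ℕ → ℝ} (hκ : Tendsto κ atTop (𝓝 0)) (hκ0 : ∀ j, 0 ≤ κ j)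
    (h : ∀ j w, ‖𝓕 (F j) w‖ ≤ C * (1 + ‖(2 * Real.pi) • w‖ ^ 2) ^ (-r / 2) +
      κ j * (1 + ‖(2 * Real.pi) • w‖) ^ N) :
    T.toTempered ∈ P.zygmund (r - d) := by
  have h2π := Real.two_pi_pos
  set V := volume.real (Metric.ball (0 : Eu d) 1)
  have hV : 0 ≤ V := measureReal_nonneg
  have hnorm : ∀ {t : ℝ}, 0 < t → ∀ w : Eu d, ‖t • w‖ = t * ‖w‖ := fun ht w => by
    rw [norm_smul, Real.norm_of_nonneg ht.le]
  have hLP : ∃ B : ℝ, ∀ x, ‖conv T.toTempered P.lowPass x‖ ≤ B := by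
    set Z : 𝓢(Eu d, ℂ) := HasCompactSupport.toSchwartzMap (f := fun y => (P.θ y : ℂ))
      (P.hasCompactSupport.comp_left (g := fun t : ℝ => (t : ℂ)) Complex.ofReal_zero)
      (Complex.ofRealCLM.contDiff.comp P.smooth) with hZ
    have hZ' : ∀ y, Z y = (P.θ y : ℂ) := fun y => rfl
    refine ⟨_, fun x => hTF.norm_conv_le h2π Z x (κ := fun j => κ j * 2 ^ N)
      (A := C * (1 ^ (-r / 2) + 2 ^ (-r / 2)))
      (m := SchwartzMap.seminorm ℝ 0 0 Z) (ρ := (2 * Real.pi)⁻¹) (by simpa using hκ.mul_const _)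
      (by positivity) (fun j => mul_nonneg (hκ0 j) (by positivity)) (by positivity)
      (SchwartzMap.norm_le_seminorm ℝ Z) fun w hw => ?_⟩
    have hw1 : ‖(2 * Real.pi) • w‖ ≤ 1 := P.norm_le_one_of_θ_ne_zero (by
      simpa [hZ'] using hw)
    refine ⟨?_, fun j => (h j w).trans ?_⟩
    · rw [hnorm h2π] at hw1
      rw [← one_div, le_div_iff₀ h2π]
      linarith
    · have hw0 := norm_nonneg ((2 * Real.pi) • w)
      have := hκ0 j
      gcongr
      · exact rpow_le_add_of_mem_Icc one_pos (by nlinarith) (by nlinarith)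
      · linarith
  have hW : ∃ B : ℝ, 0 ≤ B ∧ ∀ (ε : Eps) x,
      ‖conv T.toTempered (dilate ε ε.2.1 P.wavelet) x‖ ≤ B * (ε : ℝ) ^ (r - d) := by
    set Z : 𝓢(Eu d, ℂ) := HasCompactSupport.toSchwartzMap (f := fun y => (P.ζ y : ℂ))
      (P.ζ_hasCompactSupport.comp_left (g := fun t : ℝ => (t : ℂ)) Complex.ofReal_zero)
      (Complex.ofRealCLM.contDiff.comp P.ζ_smooth) with hZ
    have hZ' : ∀ y, Z y = (P.ζ y : ℂ) := fun y => rfl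
    have hwav : P.wavelet = dilate (2 * Real.pi) Real.two_pi_pos (𝓕⁻ Z) := rfl
    refine ⟨C * ((1 / 4) ^ (-r / 2) + 2 ^ (-r / 2)) * SchwartzMap.seminorm ℝ 0 0 Z *
      ((2 * Real.pi)⁻¹ ^ d * V), by positivity, fun ε x => ?_⟩
    obtain ⟨ε, hε⟩ := ε
    have hε0 : 0 < ε := hε.1
    rw [hwav, dilate_dilate]
    -- The frequencies involved satisfy `‖2π w‖ ≤ ε⁻¹`. The resulting error is not uniform in `ε`,
    -- but the limit in `j` is taken first.
    refine (hTF.norm_conv_le (mul_pos hε0 h2π) Z x (κ := fun j => κ j * (1 + ε⁻¹) ^ N)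
      (A := C * (((1 / 4) ^ (-r / 2) + 2 ^ (-r / 2)) * ε ^ r))
      (m := SchwartzMap.seminorm ℝ 0 0 Z) (ρ := (2 * Real.pi)⁻¹ * ε⁻¹)
      (by simpa using hκ.mul_const _)
      (by positivity) (fun j => mul_nonneg (hκ0 j) (by positivity)) (by positivity)
      (SchwartzMap.norm_le_seminorm ℝ Z) fun w hw => ?_).trans (le_of_eq ?_)
    · have hw1 := P.norm_mem_of_ζ_ne_zero (y := (ε * (2 * Real.pi)) • w) (by
        simpa [hZ'] using hw)
      rw [mul_smul, hnorm hε0] at hw1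
      have hw2 : ‖(2 * Real.pi) • w‖ ≤ ε⁻¹ := by
        rw [← one_div, le_div_iff₀ hε0]
        linarith [hw1.2]
      refine ⟨?_, fun j => (h j w).trans ?_⟩
      · rw [hnorm h2π] at hw2
        rwa [← div_eq_inv_mul, le_div_iff₀ h2π, mul_comm]
      · have := hκ0 j
        gcongr
        exact one_add_sq_rpow_le hε0 hε.2 hw1.1 hw1.2 r
    · rw [Real.rpow_sub hε0, Real.rpow_natCast]
      simp only [mul_pow, inv_pow]
      ring
  obtain ⟨B, hB⟩ := hLP
  obtain ⟨B', hB'0, hB'⟩ := hW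
  refine ENNReal.add_lt_top.2 ⟨?_, ?_⟩
  · rw [eLpNorm_exponent_top]
    exact (eLpNormEssSup_le_of_ae_bound (Eventually.of_forall hB)).trans_lt ENNReal.ofReal_lt_top
  · refine (iSup_le fun ε => ?_ : _ ≤ ENNReal.ofReal B').trans_lt ENNReal.ofReal_lt_top
    have hε := ε.2.1
    rw [eLpNorm_exponent_top]
    refine (mul_le_mul_right (eLpNormEssSup_le_of_ae_bound
      (Eventually.of_forall (hB' ε))) _).trans ?_
    rw [← ENNReal.ofReal_mul (by positivity), mul_left_comm, ← Real.rpow_add hε]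
    simp

/-! ### Smoothness of convolutions with distributions of order zero -/

open LineDeriv

theorem lineDerivOp_reflectAt (v : Eu d) (φ : 𝓢(Eu d, ℂ)) (x : Eu d) :
    ∂_{v} (reflectAt φ x) = -reflectAt (∂_{v} φ) x := by
  ext y
  rw [SchwartzMap.lineDerivOp_apply_eq_fderiv]
  have h1 : HasFDerivAt (fun y : Eu d => x - y) (-ContinuousLinearMap.id ℝ (Eu d)) y :=
    (hasFDerivAt_id y).const_sub x
  have h2 : HasFDerivAt (reflectAt φ x)
      ((fderiv ℝ φ (x - y)).comp (-ContinuousLinearMap.id ℝ (Eu d))) y := by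
    have := (φ.hasFDerivAt (x - y)).comp y h1
    refine this.congr_of_eventuallyEq (Eventually.of_forall fun z => ?_)
    simp [reflectAt_apply]
  rw [h2.fderiv]
  simp [reflectAt_apply, SchwartzMap.lineDerivOp_apply_eq_fderiv]

/-- Repeated integration by parts: each sign cancels against the sign from the reflection. The
derivatives come out in reverse order, whence the new index `i'`. -/
theorem exists_integral_mul_iteratedLineDeriv {n : ℕ} (i : Fin n → Fin d) :
    ∃ i' : Fin n → Fin d, ∀ (F ψ : 𝓢(Eu d, ℂ)) (x : Eu d),
      ∫ y, F y * reflectAt (∂^{fun j => EuclideanSpace.single (i j) (1 : ℝ)} ψ) x y =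
        ∫ y, (∂^{fun j => EuclideanSpace.single (i' j) (1 : ℝ)} F) y * reflectAt ψ x y := by
  induction n with
  | zero => exact ⟨i, fun F ψ x => by simp⟩
  | succ n ih =>
    obtain ⟨i', hi'⟩ := ih (Fin.init i)
    refine ⟨Fin.cons (i (Fin.last n)) i', fun F ψ x => ?_⟩
    have h := hi' F (∂_{EuclideanSpace.single (i (Fin.last n)) (1 : ℝ)} ψ) x
    rw [iteratedLineDerivOp_succ_right, iteratedLineDerivOp_succ_left]
    refine h.trans ?_
    have h2 := SchwartzMap.integral_mul_lineDerivOp_right_eq_neg_left (μ := volume)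
      (∂^{fun j => EuclideanSpace.single (i' j) (1 : ℝ)} F) (reflectAt ψ x)
      (EuclideanSpace.single (i (Fin.last n)) (1 : ℝ))
    rw [lineDerivOp_reflectAt] at h2
    simp only [neg_apply, mul_neg, integral_neg, neg_inj] at h2
    exact h2

theorem exists_norm_sub_sub_lineDeriv_le (φ : 𝓢(Eu d, ℂ)) :
    ∃ K : ℝ, 0 ≤ K ∧ ∀ x v : Eu d, ‖φ (x + v) - φ x - (∂_{v} φ) x‖ ≤ K * ‖v‖ ^ 2 := by
  set φ' := SchwartzMap.fderivCLM ℝ (Eu d) ℂ φ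
  set φ'' := SchwartzMap.fderivCLM ℝ (Eu d) (Eu d →L[ℝ] ℂ) φ'
  set K := SchwartzMap.seminorm ℝ 0 0 φ''
  have hK : ∀ x, ‖fderiv ℝ φ' x‖ ≤ K := SchwartzMap.norm_le_seminorm ℝ φ''
  have h1 : ∀ x y, ‖φ' x - φ' y‖ ≤ K * ‖x - y‖ := fun x y =>
    convex_univ.norm_image_sub_le_of_norm_fderiv_le (𝕜 := ℝ)
      (fun z _ => φ'.differentiableAt) (fun z _ => hK z) (Set.mem_univ y) (Set.mem_univ x)
  refine ⟨K, apply_nonneg _ _, fun x v => ?_⟩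
  have h2 := (convex_closedBall x ‖v‖).norm_image_sub_le_of_norm_hasFDerivWithin_le'
    (f := φ) (f' := fun z => φ' z) (φ := φ' x) (C := K * ‖v‖) (x := x) (y := x + v)
    (fun z _ => (φ.hasFDerivAt z).hasFDerivWithinAt)
    (fun z hz => (h1 z x).trans (by
      gcongr
      exact mem_closedBall_iff_norm.1 hz)) (by simp) (by simp)
  rw [add_sub_cancel_left] at h2
  calc _ ≤ K * ‖v‖ * ‖v‖ := h2
    _ = _ := by ring

namespace CompactDistribution

variable {Ω : Opens (Eu d)} {T : CompactDistribution Ω}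

/-- `T` is a distribution of order zero, with bound `C` for functions bounded on `U`. -/
def OrderZeroBound (T : CompactDistribution Ω) (U : Set (Eu d)) (C : ℝ) : Prop :=
  ∀ (h : smoothOn Ω) (B : ℝ), (∀ x ∈ U, ‖(h : Eu d → ℂ) x‖ ≤ B) →
    ‖T.toLinearMap h‖ ≤ C * B

/-- The linear map `v ↦ (T * ∂_v φ)(x)`. -/
def convDeriv (T : CompactDistribution Ω) (φ : 𝓢(Eu d, ℂ)) (x : Eu d) : Eu d →L[ℝ] ℂ :=
  LinearMap.toContinuousLinearMap
    { toFun v := conv T.toTempered (∂_{v} φ) x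
      map_add' v w := by
        simp only [conv, reflectAt, lineDerivOp_left_add, map_add]
      map_smul' c v := by
        simp only [conv, reflectAt, lineDerivOp_left_smul, RingHom.id_apply]
        simp only [← Complex.coe_smul, map_smul] }

theorem convDeriv_apply (φ : 𝓢(Eu d, ℂ)) (x v : Eu d) :
    T.convDeriv φ x v = conv T.toTempered (∂_{v} φ) x := rfl

theorem OrderZeroBound.norm_conv_le {U : Set (Eu d)} {C : ℝ} (hT : T.OrderZeroBound U C)
    {φ : 𝓢(Eu d, ℂ)} {B : ℝ} (hφ : ∀ y, ‖φ y‖ ≤ B) (x : Eu d) :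
    ‖conv T.toTempered φ x‖ ≤ C * B :=
  hT ⟨reflectAt φ x, schwartz_mem_smoothOn Ω _⟩ B fun y _ => by
    simpa [reflectAt_apply] using hφ (x - y)

/-- For order zero, a Taylor remainder of `φ` that is `O(‖v‖²)` in sup norm suffices; no convergence
of difference quotients in the Schwartz topology is needed. -/
theorem OrderZeroBound.hasFDerivAt_conv {U : Set (Eu d)} {C : ℝ} (hT : T.OrderZeroBound U C)
    (φ : 𝓢(Eu d, ℂ)) (x : Eu d) :
    HasFDerivAt (conv T.toTempered φ) (T.convDeriv φ x) x := by
  obtain ⟨K, hK, h⟩ := exists_norm_sub_sub_lineDeriv_le φ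
  rw [hasFDerivAt_iff_isLittleO_nhds_zero]
  have h1 : (fun v => conv T.toTempered φ (x + v) - conv T.toTempered φ x - T.convDeriv φ x v)
      =O[𝓝 0] fun v => ‖v‖ ^ 2 := by
    refine Asymptotics.IsBigO.of_bound (C * K) (Eventually.of_forall fun v => ?_)
    have h2 : conv T.toTempered φ (x + v) - conv T.toTempered φ x - T.convDeriv φ x v =
        T.toLinearMap ⟨(reflectAt φ (x + v) - reflectAt φ x - reflectAt (∂_{v} φ) x : 𝓢(Eu d, ℂ)),
          schwartz_mem_smoothOn Ω _⟩ := by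
      rw [convDeriv_apply, conv, conv, conv, ← map_sub, ← map_sub, toTempered_apply]
    rw [h2, norm_pow, norm_norm, mul_assoc]
    refine hT _ _ fun y _ => ?_
    have := h (x - y) v
    simpa [reflectAt_apply, add_sub_right_comm] using this
  exact h1.trans_isLittleO (Asymptotics.isLittleO_norm_pow_id one_lt_two)

theorem OrderZeroBound.contDiff_conv {U : Set (Eu d)} {C : ℝ} (hT : T.OrderZeroBound U C)
    (φ : 𝓢(Eu d, ℂ)) : ContDiff ℝ ∞ (conv T.toTempered φ) := by
  refine contDiff_infty.2 fun n => ?_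
  induction n generalizing φ with
  | zero =>
    exact contDiff_zero.2 (continuous_iff_continuousAt.2
      fun x => (hT.hasFDerivAt_conv φ x).continuousAt)
  | succ n ih =>
    push_cast
    refine contDiff_succ_iff_fderiv_apply.2
      ⟨fun x => (hT.hasFDerivAt_conv φ x).differentiableAt, by simp, fun v => ?_⟩
    simp_rw [(hT.hasFDerivAt_conv φ _).fderiv, convDeriv_apply]
    exact ih _

theorem OrderZeroBound.iteratedFDeriv_conv {U : Set (Eu d)} {C : ℝ} (hT : T.OrderZeroBound U C)
    (φ : 𝓢(Eu d, ℂ)) {n : ℕ} (m : Fin n → Eu d) (x : Eu d) :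
    iteratedFDeriv ℝ n (conv T.toTempered φ) x m = conv T.toTempered (∂^{m} φ) x := by
  induction n generalizing x with
  | zero => simp
  | succ n ih =>
    rw [iteratedLineDerivOp_succ_left, iteratedFDeriv_succ_apply_left,
      ← fderiv_continuousMultilinear_apply_const_apply]
    · simp only [ih, (hT.hasFDerivAt_conv _ _).fderiv, convDeriv_apply]
    · exact (hT.contDiff_conv φ).differentiable_iteratedFDeriv
        (mod_cast ENat.natCast_lt_top n) x

end CompactDistribution

/-! ### Derivatives and norms of dilated functions. -/

theorem lineDerivOp_dilate {c : ℝ} (hc : 0 < c) (v : Eu d) (φ : 𝓢(Eu d, ℂ)) :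
    ∂_{v} (dilate c hc φ) = (c : ℂ)⁻¹ • dilate c hc (∂_{v} φ) := by
  simp only [dilate, lineDerivOp_smul, SchwartzMap.lineDerivOp_compCLMOfContinuousLinearEquiv]
  have : dilationEquiv c hc v = c⁻¹ • v := rfl
  rw [this, lineDerivOp_left_smul, smul_comm, ← Complex.coe_smul, map_smul]
  push_cast
  rfl

theorem iteratedLineDerivOp_dilate {c : ℝ} (hc : 0 < c) {n : ℕ} (m : Fin n → Eu d)
    (φ : 𝓢(Eu d, ℂ)) :
    ∂^{m} (dilate c hc φ) = ((c : ℂ)⁻¹ ^ n) • dilate c hc (∂^{m} φ) := by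
  induction n with
  | zero => simp
  | succ n ih =>
    rw [iteratedLineDerivOp_succ_left, ih, lineDerivOp_smul, lineDerivOp_dilate, smul_smul,
      ← pow_succ, iteratedLineDerivOp_succ_left]

theorem norm_dilate_le {c : ℝ} (hc : 0 < c) (φ : 𝓢(Eu d, ℂ)) (x : Eu d) :
    ‖dilate c hc φ x‖ ≤ c⁻¹ ^ d * SchwartzMap.seminorm ℝ 0 0 φ := by
  rw [dilate_apply, norm_mul, norm_inv, norm_pow, Complex.norm_real, Real.norm_of_nonneg hc.le,
    inv_pow]
  gcongr
  exact SchwartzMap.norm_le_seminorm ℝ φ _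

theorem integral_norm_dilate {c : ℝ} (hc : 0 < c) (φ : 𝓢(Eu d, ℂ)) :
    ∫ y, ‖dilate c hc φ y‖ = ∫ y, ‖φ y‖ := by
  have h1 := Measure.integral_comp_inv_smul (μ := (volume : Measure (Eu d))) (fun y => ‖φ y‖) c
  simp only [dilate_apply, norm_mul, norm_inv, norm_pow, Complex.norm_real,
    Real.norm_of_nonneg hc.le, integral_const_mul]
  rw [h1, finrank_euclideanSpace, Fintype.card_fin, abs_of_pos (pow_pos hc d), smul_eq_mul,
    inv_mul_cancel_left₀ (pow_pos hc d).ne']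

/-! ### Regularization of Schwartz functions -/

/-- Fubini's theorem for the regularization of a Schwartz function. -/
theorem integral_mul_integral_reflectAt (F ρ ψ : 𝓢(Eu d, ℂ)) :
    ∫ x, ρ x * ∫ y, F y * reflectAt ψ x y = ∫ y, F y * ∫ z, ρ (y + z) * ψ z := by
  have h1 : Integrable (fun p : Eu d × Eu d => (ρ p.1 * F p.2) * ψ (p.1 - p.2))
      (volume.prod volume) := by
    refine (ρ.integrable.mul_prod F.integrable).mul_bdd
      (c := SchwartzMap.seminorm ℝ 0 0 ψ) ?_ (Eventually.of_forall fun p =>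
        SchwartzMap.norm_le_seminorm ℝ ψ _)
    exact (ψ.continuous.comp (continuous_fst.sub continuous_snd)).aestronglyMeasurable
  have h2 := integral_integral_swap (f := fun x y => (ρ x * F y) * ψ (x - y)) h1
  calc ∫ x, ρ x * ∫ y, F y * reflectAt ψ x y
      = ∫ x, ∫ y, (ρ x * F y) * ψ (x - y) := by
        refine integral_congr_ae (Eventually.of_forall fun x => ?_)
        simp only [reflectAt_apply, ← integral_const_mul, mul_assoc]
    _ = ∫ y, ∫ x, (ρ x * F y) * ψ (x - y) := h2
    _ = ∫ y, F y * ∫ z, ρ (y + z) * ψ z := by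
        refine integral_congr_ae (Eventually.of_forall fun y => ?_)
        simp only
        rw [← integral_const_mul, ← integral_add_left_eq_self _ y]
        refine integral_congr_ae (Eventually.of_forall fun z => ?_)
        simp only [add_sub_cancel_left]
        ring

/-- After rescaling the integral, `ρ` is Lipschitz and `φ` has a finite first absolute moment. -/
theorem exists_norm_sub_integral_dilate_le (ρ φ : 𝓢(Eu d, ℂ)) (hφ : ∫ t, φ t = 1) :
    ∃ K : ℝ, 0 ≤ K ∧ ∀ (c : ℝ) (hc : 0 < c) (y : Eu d),
      ‖ρ y - ∫ z, ρ (y + z) * dilate c hc φ z‖ ≤ K * c := by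
  set L := SchwartzMap.seminorm ℝ 0 0 (SchwartzMap.fderivCLM ℝ (Eu d) ℂ ρ)
  have hL : ∀ x y, ‖ρ x - ρ y‖ ≤ L * ‖x - y‖ := fun x y =>
    convex_univ.norm_image_sub_le_of_norm_fderiv_le (𝕜 := ℝ)
      (fun z _ => ρ.differentiableAt)
      (fun z _ => SchwartzMap.norm_le_seminorm ℝ (SchwartzMap.fderivCLM ℝ (Eu d) ℂ ρ) z)
      (Set.mem_univ y) (Set.mem_univ x)
  have hL0 : 0 ≤ L := apply_nonneg _ _
  have hint : Integrable (fun z : Eu d => ‖z‖ * ‖φ z‖) := by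
    simpa using φ.integrable_pow_mul volume 1
  refine ⟨L * ∫ z, ‖z‖ * ‖φ z‖, mul_nonneg hL0 (integral_nonneg fun z => by positivity),
    fun c hc y => ?_⟩
  rw [integral_dilate_smul hc φ (fun z => ρ (y + z))]
  have h1 : ρ y = ∫ z, ρ y * φ z := by rw [integral_const_mul, hφ, mul_one]
  have h2 : Integrable fun z => ρ (y + c • z) * φ z := by
    refine φ.integrable.bdd_mul (c := SchwartzMap.seminorm ℝ 0 0 ρ) ?_
      (Eventually.of_forall fun p => SchwartzMap.norm_le_seminorm ℝ ρ _)
    exact (ρ.continuous.comp (by fun_prop)).aestronglyMeasurable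
  rw [h1, ← integral_sub (φ.integrable.const_mul _) h2]
  have h3 : L * (∫ z, ‖z‖ * ‖φ z‖) * c = ∫ z, L * c * (‖z‖ * ‖φ z‖) := by
    rw [integral_const_mul]
    ring
  rw [h3]
  refine norm_integral_le_of_norm_le (hint.const_mul _) (Eventually.of_forall fun z => ?_)
  rw [← sub_mul, norm_mul, ← mul_assoc]
  gcongr
  refine (hL _ _).trans (le_of_eq ?_)
  rw [sub_add_cancel_left, norm_neg, norm_smul, Real.norm_of_nonneg hc.le]
  ring

/-! ### Weak limits of bounded sequences -/

namespace WeakLimit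

variable {Ω : Opens (Eu d)} {T : CompactDistribution Ω} {F : ℕ → 𝓢(Eu d, ℂ)}

theorem orderZeroBound (hTF : WeakLimit T F) {U : Set (Eu d)} (hU : volume U ≠ ⊤)
    (hFU : ∀ j, ∀ x ∉ U, F j x = 0) {M : ℝ} (hM : ∀ j x, ‖F j x‖ ≤ M) :
    T.OrderZeroBound U (M * volume.real U) := by
  intro h B hB
  refine le_of_tendsto' (hTF h).norm fun j => ?_
  rw [← setIntegral_eq_integral_of_forall_compl_eq_zero (s := U)
    (f := fun x => F j x * (h : Eu d → ℂ) x) (fun x hx => by rw [hFU j x hx, zero_mul])]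
  refine (norm_setIntegral_le_of_norm_le_const (C := M * B) hU.lt_top fun x hx => ?_).trans
    (le_of_eq (by ring))
  rw [norm_mul]
  exact mul_le_mul (hM j x) (hB x hx) (norm_nonneg _) ((norm_nonneg _).trans (hM j x))

/-- The derivatives move onto `F j`, leaving only the `L¹` norm of `ψ`. For `ψ = φ_ε` this norm does
not depend on `ε`. -/
theorem norm_conv_iteratedLineDeriv_le (hTF : WeakLimit T F) {k : ℕ} {M : ℝ}
    (hM : ∀ j, ∀ n ≤ k, ∀ (i : Fin n → Fin d) (x : Eu d), ‖partialD i (F j) x‖ ≤ M)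
    {n : ℕ} (hn : n ≤ k) (i : Fin n → Fin d) (ψ : 𝓢(Eu d, ℂ)) (x : Eu d) :
    ‖conv T.toTempered (∂^{fun j => EuclideanSpace.single (i j) (1 : ℝ)} ψ) x‖ ≤
      M * ∫ y, ‖ψ y‖ := by
  obtain ⟨i', hi'⟩ := exists_integral_mul_iteratedLineDeriv i
  refine le_of_tendsto' (hTF.tendsto_conv _ x).norm fun j => ?_
  rw [hi', ← integral_sub_left_eq_self (fun y => ‖ψ y‖) _ x, ← integral_const_mul]
  refine norm_integral_le_of_norm_le ?_ (Eventually.of_forall fun y => ?_)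
  · have := (reflectAt ψ x).integrable (μ := volume).norm.const_mul M
    simpa only [reflectAt_apply] using this
  · rw [norm_mul, reflectAt_apply, ← schwartz_partialD]
    gcongr
    exact hM j n hn i' y

/-- For `F j`, Fubini moves the mollifier onto `ρ`, where it produces an error `O(c)` uniform in
`j`. Dominated convergence in `x` transfers the estimate to `T`. -/
theorem exists_norm_sub_integral_conv_le (hTF : WeakLimit T F) {U : Set (Eu d)}
    (hU : volume U ≠ ⊤) (hFU : ∀ j, ∀ x ∉ U, F j x = 0) {M : ℝ} (hM : ∀ j x, ‖F j x‖ ≤ M)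
    (φ : 𝓢(Eu d, ℂ)) (hφ : ∫ t, φ t = 1) (ρ : 𝓢(Eu d, ℂ)) :
    ∃ K : ℝ, ∀ (c : ℝ) (hc : 0 < c),
      ‖T.toTempered ρ - ∫ x, ρ x * conv T.toTempered (dilate c hc φ) x‖ ≤ K * c := by
  obtain ⟨K, hK0, hK⟩ := exists_norm_sub_integral_dilate_le ρ φ hφ
  have hbd : ∀ (j : ℕ) (h : Eu d → ℂ) (B : ℝ), (∀ x, ‖h x‖ ≤ B) →
      ‖∫ y, F j y * h y‖ ≤ M * volume.real U * B := by
    intro j h B hB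
    rw [← setIntegral_eq_integral_of_forall_compl_eq_zero (s := U)
      (f := fun x => F j x * h x) (fun x hx => by rw [hFU j x hx, zero_mul])]
    refine (norm_setIntegral_le_of_norm_le_const (C := M * B) hU.lt_top fun x hx => ?_).trans
      (le_of_eq (by ring))
    rw [norm_mul]
    exact mul_le_mul (hM j x) (hB x) (norm_nonneg _) ((norm_nonneg _).trans (hM j x))
  refine ⟨M * volume.real U * K, fun c hc => ?_⟩
  set ψ := dilate c hc φ
  have h1 : Tendsto (fun j => ∫ x, ρ x * ∫ y, F j y * reflectAt ψ x y) atTop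
      (𝓝 (∫ x, ρ x * conv T.toTempered ψ x)) := by
    refine tendsto_integral_of_dominated_convergence
      (fun x => ‖ρ x‖ * (M * volume.real U * SchwartzMap.seminorm ℝ 0 0 ψ)) (fun j => ?_)
      (ρ.integrable.norm.mul_const _) (fun j => Eventually.of_forall fun x => ?_)
      (Eventually.of_forall fun x => (hTF.tendsto_conv ψ x).const_mul _)
    · refine ρ.continuous.aestronglyMeasurable.mul ?_
      refine AEStronglyMeasurable.integral_prod_right' (μ := volume) (ν := volume)
        (f := fun p : Eu d × Eu d => F j p.2 * reflectAt ψ p.1 p.2) ?_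
      simp only [reflectAt_apply]
      exact (((F j).continuous.comp continuous_snd).mul
        (ψ.continuous.comp (continuous_fst.sub continuous_snd))).aestronglyMeasurable
    · rw [norm_mul]
      gcongr
      exact hbd j _ _ fun y => by
        rw [reflectAt_apply]
        exact SchwartzMap.norm_le_seminorm ℝ ψ _
  have h2 := (hTF ⟨ρ, schwartz_mem_smoothOn Ω ρ⟩).sub h1
  refine le_of_tendsto' h2.norm fun j => ?_
  have hint : Integrable fun y => F j y * ∫ z, ρ (y + z) * ψ z := by
    refine (F j).integrable.mul_bdd (c := SchwartzMap.seminorm ℝ 0 0 ρ * ∫ z, ‖ψ z‖) ?_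
      (Eventually.of_forall fun y => ?_)
    · refine AEStronglyMeasurable.integral_prod_right' (μ := volume) (ν := volume)
        (f := fun p : Eu d × Eu d => ρ (p.1 + p.2) * ψ p.2) ?_
      exact ((ρ.continuous.comp (continuous_fst.add continuous_snd)).mul
        (ψ.continuous.comp continuous_snd)).aestronglyMeasurable
    · rw [← integral_const_mul]
      refine norm_integral_le_of_norm_le (ψ.integrable.norm.const_mul _)
        (Eventually.of_forall fun z => ?_)
      rw [norm_mul]
      gcongr
      exact SchwartzMap.norm_le_seminorm ℝ ρ _
  have hint' : Integrable fun y => F j y * ρ y :=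
    (F j).integrable.mul_bdd (c := SchwartzMap.seminorm ℝ 0 0 ρ)
      ρ.continuous.aestronglyMeasurable
      (Eventually.of_forall fun y => SchwartzMap.norm_le_seminorm ℝ ρ _)
  rw [integral_mul_integral_reflectAt, ← integral_sub hint' hint]
  simp only [← mul_sub]
  rw [mul_assoc]
  exact hbd j _ _ fun y => hK c hc y

end WeakLimit

/-! ### Classes of nets -/

/-- If no calibration is positive, the net has class `(∞, h)` with `h ≤ 0`. Otherwise let `i > k` be
the least order with a positive calibration: the class is `(i - 1, 0)`. A competing pair with
negative second entry would make all calibrations of order zero negative, which `h0` excludes. -/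
theorem mem_moderateClass_of_calibration_le {Ω : Opens (Eu d)} {g : Net Ω} (hg : g ∈ moderate Ω)
    {k : ℕ} (hk : ∀ V, RelCompact V Ω → ∀ i ≤ k, calibration V i g ≤ 0)
    (h0 : (∀ V, RelCompact V Ω → calibration V 0 g < 0) →
      ∀ V, RelCompact V Ω → ∀ i, calibration V i g ≤ 0) :
    g ∈ moderateClass Ω (k : ℕ∞) 0 := by
  classical
  refine ⟨hg, ?_⟩
  by_cases hall : ∀ V, RelCompact V Ω → ∀ i, calibration V i g ≤ 0
  · refine ⟨⊤, le_top, sInf ((fun a : ℝ => (a : EReal)) '' {a | ∀ U, RelCompact U Ω →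
      ∀ (n : ℕ) (i : Fin n → Fin d),
        IsBigOPow (fun ε => ENNReal.ofReal ((ε : ℝ) ^ a) * partialNorm i U (g ε)) 0}), ?_, ?_, rfl⟩
    · refine EReal.le_of_forall_lt_iff_le.1 fun a ha => ?_
      refine sInf_le ⟨a, fun V hV n i => ?_, rfl⟩
      refine (exists_mem_exponents_of_calibration_lt ((hall V hV n).trans_lt ha)).mono fun ε => ?_
      gcongr
      exact partialNorm_le_sobolevNorm le_rfl i V (g ε)
    -- Any positive exponent is admissible; `1` shows that the infimum is not `⊤`.
    · refine ne_top_of_le_ne_top (b := ((1 : ℝ) : EReal)) (EReal.coe_ne_top 1) ?_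
      refine sInf_le ⟨1, fun V hV n i => ?_, rfl⟩
      have ha : calibration V n g < ((1 : ℝ) : EReal) :=
        (hall V hV n).trans_lt (by exact_mod_cast one_pos)
      refine (exists_mem_exponents_of_calibration_lt ha).mono fun ε => ?_
      gcongr
      exact partialNorm_le_sobolevNorm le_rfl i V (g ε)
  · have hex : ∃ i, ∃ V, RelCompact V Ω ∧ 0 < calibration V i g := by
      push Not at hall
      obtain ⟨V, hV, i, hi⟩ := hall
      exact ⟨i, V, hV, hi⟩
    obtain ⟨V, hV, hi⟩ := Nat.find_spec hex
    have hmin := fun {m} => Nat.find_min hex (m := m)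
    set i := Nat.find hex
    have hki : k < i := by
      by_contra hik
      exact (hk V hV i (not_lt.1 hik)).not_gt hi
    obtain ⟨l, hl⟩ : ∃ l, i = l + 1 := ⟨i - 1, by omega⟩
    refine ⟨(l : ℕ), Nat.cast_le.2 (by omega), 0, le_rfl, EReal.zero_ne_top,
      ⟨fun W hW m hm => ?_, V, hV, hl ▸ hi⟩, ?_⟩
    · by_contra hlt
      exact hmin (by omega) ⟨W, hW, not_le.1 hlt⟩
    · rintro ⟨s, hs, l', hl', -⟩
      exact hall (h0 fun W hW => (hl' W hW 0 (Nat.zero_le _)).trans_lt hs)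

theorem moderateClass_mono {Ω : Opens (Eu d)} {k : ℕ∞} {s t : EReal} (hst : s ≤ t) :
    moderateClass Ω k s ⊆ moderateClass Ω k t := by
  rintro g ⟨hg, i, hi, h, hh, hc⟩
  exact ⟨hg, i, hi, h, hh.trans hst, hc⟩

theorem partialNorm_le_of_bound {n : ℕ} {i : Fin n → Fin d} {V : Set (Eu d)} {f : Eu d → ℂ}
    {B : ℝ} (h : ∀ x, ‖partialD i f x‖ ≤ B) : partialNorm i V f ≤ ENNReal.ofReal B := by
  rw [partialNorm, eLpNorm_exponent_top]
  exact eLpNormEssSup_le_of_ae_bound (Eventually.of_forall h)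

/-! ### The embedding of a distribution of order zero -/

namespace CompactDistribution

variable {Ω : Opens (Eu d)} {T : CompactDistribution Ω}

/-- The net `(T * φ_ε |_Ω)_ε`. -/
def OrderZeroBound.net {U : Set (Eu d)} {C : ℝ} (hT : T.OrderZeroBound U C) (φ : 𝓢(Eu d, ℂ)) :
    Net Ω :=
  fun ε => ⟨conv T.toTempered (dilate ε ε.2.1 φ), (hT.contDiff_conv _).contDiffOn⟩

theorem OrderZeroBound.partialD_net {U : Set (Eu d)} {C : ℝ} (hT : T.OrderZeroBound U C)
    (φ : 𝓢(Eu d, ℂ)) (ε : Eps) {n : ℕ} (i : Fin n → Fin d) (x : Eu d) :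
    partialD i (hT.net φ ε) x = conv T.toTempered
      (∂^{fun j => EuclideanSpace.single (i j) (1 : ℝ)} (dilate ε ε.2.1 φ)) x :=
  hT.iteratedFDeriv_conv _ _ x

theorem OrderZeroBound.net_mem_moderate {U : Set (Eu d)} {C : ℝ} (hC : 0 ≤ C)
    (hT : T.OrderZeroBound U C) (φ : 𝓢(Eu d, ℂ)) : hT.net φ ∈ moderate Ω := by
  intro m V hV
  refine ⟨-(m + d : ℕ), ?_⟩
  simp only [sobolevNorm_eq_iSup]
  refine IsBigOPow.finite_iSup fun p => ?_
  obtain ⟨⟨n, hn⟩, i⟩ := p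
  set S := SchwartzMap.seminorm ℝ 0 0
    (∂^{fun j => EuclideanSpace.single (i j) (1 : ℝ)} φ)
  have hS : 0 ≤ S := apply_nonneg _ _
  refine ⟨⟨C * S, mul_nonneg hC hS⟩, Eventually.of_forall fun ε => ?_⟩
  have hε := ε.2.1
  have h1 : ∀ x, ‖partialD i (hT.net φ ε) x‖ ≤ C * S * (ε : ℝ) ^ (-((m + d : ℕ) : ℝ)) := by
    intro x
    rw [hT.partialD_net, mul_assoc]
    refine hT.norm_conv_le (fun y => ?_) x
    rw [iteratedLineDerivOp_dilate, _root_.smul_apply, norm_smul, norm_pow, norm_inv,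
      Complex.norm_real, Real.norm_of_nonneg hε.le]
    calc (ε : ℝ)⁻¹ ^ n * ‖dilate ε hε _ y‖ ≤ (ε : ℝ)⁻¹ ^ n * ((ε : ℝ)⁻¹ ^ d * S) := by
          gcongr
          exact norm_dilate_le hε _ y
      _ = S * (ε : ℝ)⁻¹ ^ (n + d) := by ring
      _ ≤ S * (ε : ℝ)⁻¹ ^ (m + d) := by
          gcongr
          · exact (one_le_inv₀ hε).2 ε.2.2.le
          · omega
      _ = _ := by rw [Real.rpow_neg hε.le, Real.rpow_natCast, inv_pow]
  refine (partialNorm_le_of_bound h1).trans (le_of_eq ?_)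
  rw [ENNReal.ofReal_mul (mul_nonneg hC hS)]
  congr 1
  exact ENNReal.ofReal_eq_coe_nnreal _

end CompactDistribution

/-- A negative calibration makes `T * φ_ε` tend to zero uniformly near the support of a test
function `ρ`, whereas `∫ ρ (T * φ_ε)` tends to `⟨T, ρ⟩`. -/
theorem WeakLimit.eq_zero_of_calibration_neg {Ω : Opens (Eu d)} {T : CompactDistribution Ω}
    {F : ℕ → 𝓢(Eu d, ℂ)} (hTF : WeakLimit T F) {U : Set (Eu d)}
    (hU : RelCompact U Ω) (hTU : T.supp ⊆ U) (hUv : volume U ≠ ⊤)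
    (hFU : ∀ j, ∀ x ∉ U, F j x = 0)
    {M : ℝ} (hM : ∀ j x, ‖F j x‖ ≤ M) {C : ℝ} (hT : T.OrderZeroBound U C)
    {φ : 𝓢(Eu d, ℂ)} (hφ : ∫ t, φ t = 1)
    (h : ∀ V, RelCompact V Ω → calibration V 0 (hT.net φ) < 0) (f : smoothOn Ω) :
    T.toLinearMap f = 0 := by
  obtain ⟨ρ, hρ, -⟩ := T.exists_testFunction_eq hU hTU f
  rw [hρ]
  let R : 𝓢(Eu d, ℂ) := ρ.hasCompactSupport.toSchwartzMap ρ.contDiff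
  have hR : T.pair ρ = T.toTempered R := rfl
  obtain ⟨K, hK⟩ := hTF.exists_norm_sub_integral_conv_le hUv hFU hM φ hφ R
  obtain ⟨L, hL, hρL, hLΩ⟩ := exists_compact_between ρ.hasCompactSupport.isCompact Ω.isOpen
    ρ.tsupport_subset
  have hcl : closure (interior L) ⊆ L := closure_minimal interior_subset hL.isClosed
  have hV : RelCompact (interior L) Ω :=
    ⟨isOpen_interior, hL.of_isClosed_subset isClosed_closure hcl, hcl.trans hLΩ⟩
  obtain ⟨_, ⟨a, ⟨A, hA⟩, rfl⟩, ha0⟩ := sInf_lt_iff.1 (h _ hV)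
  have ha0' : a < 0 := EReal.coe_lt_coe_iff.1 ha0
  have h1 : ∀ᶠ ε : Eps in epsZero, ‖T.toTempered R‖ ≤
      K * (ε : ℝ) + A * (ε : ℝ) ^ (-a) * ∫ x, ‖R x‖ := by
    filter_upwards [hA] with ε hε
    have hp : 0 < (ε : ℝ) ^ a := Real.rpow_pos_of_pos ε.2.1 _
    have hsob : sobolevNorm 0 (interior L) (hT.net φ ε) ≤
        ENNReal.ofReal (A * (ε : ℝ) ^ (-a)) := by
      rw [Real.rpow_neg ε.2.1.le, ← div_eq_mul_inv, ENNReal.ofReal_div_of_pos hp,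
        ENNReal.le_div_iff_mul_le (Or.inl (by simpa using hp)) (Or.inl ENNReal.ofReal_ne_top),
        mul_comm]
      simpa using hε
    have hB : 0 ≤ A * (ε : ℝ) ^ (-a) :=
      mul_nonneg A.2 (Real.rpow_nonneg ε.2.1.le _)
    have hpt : ∀ x ∈ interior L, ‖conv T.toTempered (dilate ε ε.2.1 φ) x‖ ≤
        A * (ε : ℝ) ^ (-a) := fun x hx => by
      refine norm_le_of_eLpNorm_top_le isOpen_interior
        (hT.contDiff_conv _).continuous.continuousOn hB ?_ hx
      refine le_trans (le_of_eq ?_)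
        ((partialNorm_le_sobolevNorm le_rfl Fin.elim0 (interior L) (hT.net φ ε)).trans hsob)
      rw [partialNorm]
      congr 1
    have h2 : ‖∫ x, R x * conv T.toTempered (dilate ε ε.2.1 φ) x‖ ≤
        A * (ε : ℝ) ^ (-a) * ∫ x, ‖R x‖ := by
      rw [← integral_const_mul]
      refine norm_integral_le_of_norm_le (R.integrable.norm.const_mul _)
        (Eventually.of_forall fun x => ?_)
      by_cases hx : x ∈ tsupport ρ
      · rw [norm_mul, mul_comm]
        gcongr
        exact hpt x (hρL hx)
      · have : R x = 0 := image_eq_zero_of_notMem_tsupport hx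
        simp [this]
    have h3 := norm_le_norm_sub_add (T.toTempered R)
      (∫ x, R x * conv T.toTempered (dilate ε ε.2.1 φ) x)
    linarith [hK ε ε.2.1]
  have h2 : Tendsto (fun j => K * (epsSeq j : ℝ) +
      A * (epsSeq j : ℝ) ^ (-a) * ∫ x, ‖R x‖) atTop (𝓝 0) := by
    have h3 := tendsto_epsSeq_coe.const_mul K
    have h4 := ((tendsto_epsSeq_coe.rpow_const (p := -a) (Or.inr (by linarith))).const_mul
      (A : ℝ)).mul_const (∫ x, ‖R x‖)
    have h5 := h3.add h4
    rw [Real.zero_rpow (by linarith)] at h5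
    simpa using h5
  rw [hR]
  exact norm_le_zero_iff.1 (ge_of_tendsto h2 (tendsto_epsSeq.eventually h1))

theorem WeakLimit.embeddingMem {Ω : Opens (Eu d)} {T : CompactDistribution Ω}
    {F : ℕ → 𝓢(Eu d, ℂ)} (hTF : WeakLimit T F) {U : Set (Eu d)}
    (hU : RelCompact U Ω) (hTU : T.supp ⊆ U) (hFU : ∀ j, tsupport (F j) ⊆ U) {k : ℕ} {M : ℝ}
    (hM : ∀ j, ∀ n ≤ k, ∀ (i : Fin n → Fin d) (x : Eu d), ‖partialD i (F j) x‖ ≤ M)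
    {φ : 𝓢(Eu d, ℂ)} (hφ : ∫ t, φ t = 1) {s : EReal} (hs : 0 ≤ s) :
    EmbeddingMem φ T (colombeauClass Ω (k : ℕ∞) s) := by
  have hUv : volume U ≠ ⊤ :=
    ((measure_mono subset_closure).trans_lt hU.2.1.measure_lt_top).ne
  have hFU' : ∀ j, ∀ x ∉ U, F j x = 0 := fun j x hx =>
    image_eq_zero_of_notMem_tsupport fun h => hx (hFU j h)
  have hM0 : ∀ j x, ‖F j x‖ ≤ M := fun j x => by
    simpa [partialD] using hM j 0 (Nat.zero_le k) Fin.elim0 x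
  have hMnn : 0 ≤ M := (norm_nonneg _).trans (hM0 0 0)
  have hT := hTF.orderZeroBound hUv hFU' hM0
  have hmod := hT.net_mem_moderate (mul_nonneg hMnn measureReal_nonneg) φ
  refine ⟨⟨hT.net φ, hmod⟩, fun ε x _ => rfl, ⟨hT.net φ, hmod⟩, ?_, rfl⟩
  refine moderateClass_mono hs (mem_moderateClass_of_calibration_le hmod
    (fun V _ i hi => ?_) fun h V _ i => ?_)
  · refine calibration_le_of_mem (s := 0) ⟨⟨M * ∫ y, ‖φ y‖, mul_nonneg hMnn (by positivity)⟩,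
      Eventually.of_forall fun ε => ?_⟩
    simp only [Real.rpow_zero, ENNReal.ofReal_one, one_mul, mul_one]
    refine iSup_le fun n => iSup_le fun hn => iSup_le fun m => ?_
    refine (partialNorm_le_of_bound (B := M * ∫ y, ‖φ y‖) fun x => ?_).trans
      (le_of_eq (ENNReal.ofReal_eq_coe_nnreal _))
    rw [hT.partialD_net, ← integral_norm_dilate ε.2.1 φ]
    exact hTF.norm_conv_iteratedLineDeriv_le hM (hn.trans hi) m _ x
  -- In this degenerate case `T = 0`, so the net itself vanishes.
  · have hz := hTF.eq_zero_of_calibration_neg hU hTU hUv hFU' hM0 hT hφ h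
    refine calibration_le_of_mem (s := 0) ⟨0, Eventually.of_forall fun ε => ?_⟩
    have : (hT.net φ ε : Eu d → ℂ) = 0 := funext fun x => hz _
    simp [this, sobolevNorm_zero]

/-! ### Uniform polynomial bounds on characters -/

theorem contDiff_character (ξ : Eu d) : ContDiff ℝ ∞ (character ξ) := by
  unfold character
  exact (contDiff_const.mul
    (Complex.ofRealCLM.contDiff.comp (contDiff_id.inner ℝ contDiff_const))).cexp

theorem norm_character (ξ y : Eu d) : ‖character ξ y‖ = 1 := by
  simp [character, Complex.norm_exp]

theorem norm_iteratedFDeriv_character_le (ξ y : Eu d) (n : ℕ) :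
    ‖iteratedFDeriv ℝ n (character ξ) y‖ ≤ ‖ξ‖ ^ n := by
  induction n with
  | zero => simp [norm_character]
  | succ n ih =>
    set ℓ : Eu d →L[ℝ] ℂ := -(Complex.I • (Complex.ofRealCLM.comp (innerSL ℝ ξ)))
    have hℓ : ‖ℓ‖ ≤ ‖ξ‖ := by
      refine ContinuousLinearMap.opNorm_le_bound _ (norm_nonneg _) fun z => ?_
      simpa [ℓ] using abs_real_inner_le_norm ξ z
    set S : ℂ →L[ℝ] Eu d →L[ℝ] ℂ := (ContinuousLinearMap.lsmul ℝ ℂ).flip ℓ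
    have hS : ‖S‖ ≤ ‖ξ‖ := by
      refine ContinuousLinearMap.opNorm_le_bound _ (norm_nonneg _) fun z => ?_
      have : S z = z • ℓ := rfl
      rw [this, norm_smul, mul_comm]
      gcongr
    have hd : fderiv ℝ (character ξ) = S ∘ character ξ := by
      ext1 z
      have h1 : HasFDerivAt (fun y : Eu d => ℓ y) ℓ z := ℓ.hasFDerivAt
      have h2 : character ξ = fun y => Complex.exp (ℓ y) := by
        ext y
        simp [character, ℓ, real_inner_comm]
      have h3 := h1.cexp
      rw [← h2] at h3
      rw [h3.fderiv]
      simp [S, h2]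
    rw [← norm_iteratedFDeriv_fderiv, hd]
    refine (S.norm_iteratedFDeriv_comp_left (N := ∞) (contDiff_character ξ).contDiffAt
      (mod_cast le_top)).trans ?_
    rw [pow_succ, mul_comm]
    exact mul_le_mul ih hS (norm_nonneg _) (by positivity)

/-- The series `∑ c_n (1 + |ξ_n|)^{-n} e^{-i ξ_n ·}`. -/
def characterSeries (ξ : ℕ → Eu d) (c : ℕ → ℂ) (y : Eu d) : ℂ :=
  ∑' n, (c n * (((1 + ‖ξ n‖) ^ n)⁻¹ : ℝ)) * character (ξ n) y

/-- The constants in the bounds for the derivatives of `characterSeries`. -/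
def characterSeriesBound (ξ : ℕ → Eu d) (m : ℕ) : ℝ :=
  1 + ∑ n ∈ Finset.range m, (1 + ‖ξ n‖) ^ m

theorem characterSeriesBound_nonneg (ξ : ℕ → Eu d) (m : ℕ) : 0 ≤ characterSeriesBound ξ m :=
  add_nonneg zero_le_one (Finset.sum_nonneg fun _ _ => by positivity)

/-- For `n ≥ m` the weight absorbs `‖ξ n‖ ^ m`; the finitely many `n < m` go into the constant.
Hence every derivative of the series is controlled by the `ℓ¹` norm, whatever the growth of `ξ`. -/
theorem weight_mul_norm_pow_le (ξ : ℕ → Eu d) (m n : ℕ) :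
    ((1 + ‖ξ n‖) ^ n)⁻¹ * ‖ξ n‖ ^ m ≤ characterSeriesBound ξ m := by
  have h1 : 1 ≤ 1 + ‖ξ n‖ := le_add_of_nonneg_right (norm_nonneg _)
  have h2 : ‖ξ n‖ ^ m ≤ (1 + ‖ξ n‖) ^ m := by gcongr; linarith
  rw [characterSeriesBound]
  have hs : ∀ i ∈ Finset.range m, 0 ≤ (1 + ‖ξ i‖) ^ m := fun _ _ => by positivity
  rcases le_or_gt m n with hmn | hmn
  · have : ((1 + ‖ξ n‖) ^ n)⁻¹ * ‖ξ n‖ ^ m ≤ 1 := by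
      rw [inv_mul_le_iff₀ (by positivity), mul_one]
      exact h2.trans (pow_le_pow_right₀ h1 hmn)
    linarith [Finset.sum_nonneg hs]
  · have h3 := Finset.single_le_sum hs (Finset.mem_range.2 hmn)
    have h4 : ((1 + ‖ξ n‖) ^ n)⁻¹ ≤ 1 := inv_le_one_of_one_le₀ (one_le_pow₀ h1)
    nlinarith [pow_nonneg (norm_nonneg (ξ n)) m]

theorem norm_iteratedFDeriv_characterSeries_term_le (ξ : ℕ → Eu d) (c : ℕ → ℂ) (m n : ℕ)
    (y : Eu d) :
    ‖iteratedFDeriv ℝ m (fun y => (c n * (((1 + ‖ξ n‖) ^ n)⁻¹ : ℝ)) * character (ξ n) y) y‖ ≤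
      ‖c n‖ * characterSeriesBound ξ m := by
  have h : (fun y => (c n * (((1 + ‖ξ n‖) ^ n)⁻¹ : ℝ)) * character (ξ n) y) =
      (c n * (((1 + ‖ξ n‖) ^ n)⁻¹ : ℝ)) • character (ξ n) := rfl
  rw [h, iteratedFDeriv_const_smul_apply
    ((contDiff_character (ξ n)).contDiffAt.of_le (mod_cast le_top)), norm_smul, norm_mul,
    Complex.norm_real, Real.norm_of_nonneg (by positivity), mul_assoc]
  gcongr
  refine le_trans ?_ (weight_mul_norm_pow_le ξ m n)
  gcongr
  exact norm_iteratedFDeriv_character_le _ _ _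

theorem contDiff_characterSeries_term (ξ : ℕ → Eu d) (c : ℕ → ℂ) (n : ℕ) :
    ContDiff ℝ ∞ (fun y => (c n * (((1 + ‖ξ n‖) ^ n)⁻¹ : ℝ)) * character (ξ n) y) :=
  contDiff_const.mul (contDiff_character _)

theorem contDiff_characterSeries (ξ : ℕ → Eu d) {c : ℕ → ℂ} (hc : Summable fun n => ‖c n‖) :
    ContDiff ℝ ∞ (characterSeries ξ c) :=
  contDiff_tsum (N := ⊤) (v := fun m n => ‖c n‖ * characterSeriesBound ξ m)
    (fun n => contDiff_characterSeries_term ξ c n) (fun _ _ => hc.mul_right _)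
    fun m n y _ => norm_iteratedFDeriv_characterSeries_term_le ξ c m n y

theorem norm_iteratedFDeriv_characterSeries_le (ξ : ℕ → Eu d) {c : ℕ → ℂ}
    (hc : Summable fun n => ‖c n‖) (m : ℕ) (y : Eu d) :
    ‖iteratedFDeriv ℝ m (characterSeries ξ c) y‖ ≤ (∑' n, ‖c n‖) * characterSeriesBound ξ m := by
  have h := iteratedFDeriv_tsum_apply (𝕜 := ℝ) (N := ⊤)
    (v := fun m n => ‖c n‖ * characterSeriesBound ξ m)
    (fun n => contDiff_characterSeries_term ξ c n) (fun _ _ => hc.mul_right _)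
    (fun m n y _ => norm_iteratedFDeriv_characterSeries_term_le ξ c m n y) (k := m) le_top y
  have h' : iteratedFDeriv ℝ m (characterSeries ξ c) y = _ := h
  rw [h', ← tsum_mul_right]
  exact tsum_of_norm_bounded (hc.mul_right _).hasSum fun n =>
    norm_iteratedFDeriv_characterSeries_term_le ξ c m n y

theorem summable_characterSeries (ξ : ℕ → Eu d) {c : ℕ → ℂ} (hc : Summable fun n => ‖c n‖)
    (y : Eu d) :
    Summable fun n => (c n * (((1 + ‖ξ n‖) ^ n)⁻¹ : ℝ)) * character (ξ n) y :=
  .of_norm_bounded (hc.mul_right (characterSeriesBound ξ 0)) fun n => by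
    simpa using norm_iteratedFDeriv_characterSeries_term_le ξ c 0 n y

theorem lp_one_summable (c : lp (fun _ : ℕ => ℂ) 1) : Summable fun n => ‖c n‖ := by
  simpa using (memℓp_gen_iff (by simp)).1 (lp.memℓp c)

theorem lp_one_norm (c : lp (fun _ : ℕ => ℂ) 1) : ‖c‖ = ∑' n, ‖c n‖ := by
  simpa using lp.norm_eq_tsum_rpow (by simp) c

/-- The linear map `c ↦ characterSeries ξ c` from `ℓ¹` to `𝓔(Ω)`. -/
def characterSeriesLM (Ω : Opens (Eu d)) (ξ : ℕ → Eu d) :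
    lp (fun _ : ℕ => ℂ) 1 →ₗ[ℂ] smoothOn Ω where
  toFun c := ⟨characterSeries ξ c, (contDiff_characterSeries ξ (lp_one_summable c)).contDiffOn⟩
  map_add' c c' := by
    ext y
    have h := (summable_characterSeries ξ (lp_one_summable c) y).tsum_add
      (summable_characterSeries ξ (lp_one_summable c') y)
    simp only [Submodule.coe_add, Pi.add_apply, characterSeries, ← h, lp.coeFn_add]
    exact tsum_congr fun n => by ring
  map_smul' a c := by
    ext y
    simp only [Submodule.coe_smul, Pi.smul_apply, characterSeries, RingHom.id_apply, smul_eq_mul,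
      lp.coeFn_smul, ← tsum_mul_left]
    exact tsum_congr fun n => by ring

theorem characterSeriesLM_apply (Ω : Opens (Eu d)) (ξ : ℕ → Eu d) (c : lp (fun _ : ℕ => ℂ) 1) :
    (characterSeriesLM Ω ξ c : Eu d → ℂ) = characterSeries ξ c := rfl

theorem characterSeriesLM_single (Ω : Opens (Eu d)) (ξ : ℕ → Eu d) (n : ℕ) :
    characterSeriesLM Ω ξ (lp.single 1 n 1) = (((1 + ‖ξ n‖) ^ n)⁻¹ : ℝ) •
      (⟨character (ξ n), character_mem_smoothOn Ω _⟩ : smoothOn Ω) := by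
  ext y
  rw [characterSeriesLM_apply, characterSeries, tsum_eq_single n]
  · simp
  · intro m hm
    simp [hm]

/-- If the bound fails for every `N`, the offending frequencies define a continuous map from `ℓ¹` to
smooth functions. Composing with it reduces the uniform boundedness principle on a Fréchet space to
Banach-Steinhaus on `ℓ¹`. -/
theorem exists_uniform_character_bound {Ω : Opens (Eu d)} (L : ℕ → smoothOn Ω →ₗ[ℂ] ℂ)
    (hcont : ∀ j, ∃ (N : ℕ) (C : ℝ), ∀ (f : smoothOn Ω) (B : ℝ), 0 ≤ B →
      (∀ n ≤ N, ∀ x, ‖iteratedFDeriv ℝ n (f : Eu d → ℂ) x‖ ≤ B) → ‖L j f‖ ≤ C * B)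
    (hbd : ∀ f, ∃ C, ∀ j, ‖L j f‖ ≤ C) :
    ∃ N : ℕ, ∀ j ξ, ‖L j ⟨character ξ, character_mem_smoothOn Ω ξ⟩‖ ≤ N * (1 + ‖ξ‖) ^ N := by
  by_contra hcon
  push Not at hcon
  choose J ξ hJ using hcon
  have hS : ∀ j, ∃ C, ∀ c, ‖(L j ∘ₗ characterSeriesLM Ω ξ) c‖ ≤ C * ‖c‖ := by
    intro j
    obtain ⟨N, C, hC⟩ := hcont j
    have hnn := fun m => characterSeriesBound_nonneg ξ m
    refine ⟨C * ∑ m ∈ Finset.range (N + 1), characterSeriesBound ξ m, fun c => ?_⟩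
    have h1 := hC (characterSeriesLM Ω ξ c)
      ((∑ m ∈ Finset.range (N + 1), characterSeriesBound ξ m) * ‖c‖)
      (mul_nonneg (Finset.sum_nonneg fun m _ => hnn m) (norm_nonneg _)) fun m hm x => ?_
    · exact h1.trans_eq (by ring)
    · refine (norm_iteratedFDeriv_characterSeries_le ξ (lp_one_summable c) m x).trans ?_
      rw [← lp_one_norm, mul_comm]
      gcongr
      exact Finset.single_le_sum (fun m _ => hnn m) (Finset.mem_range.2 (Nat.lt_succ_of_le hm))
  choose C hC using hS
  let S : ℕ → lp (fun _ : ℕ => ℂ) 1 →L[ℂ] ℂ := fun j =>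
    (L j ∘ₗ characterSeriesLM Ω ξ).mkContinuous (C j) (hC j)
  obtain ⟨A, hA⟩ := banach_steinhaus (g := S) fun c => hbd (characterSeriesLM Ω ξ c)
  -- The `n`-th basis vector maps to the weighted `n`-th character, on which `L (J n)` exceeds `n >
  -- A`.
  obtain ⟨n, hn⟩ := exists_nat_gt A
  have h1 := (S (J n)).le_of_opNorm_le (hA (J n)) (lp.single 1 n 1)
  rw [lp.norm_single (by simp), norm_one, mul_one] at h1
  have h2 : S (J n) (lp.single 1 n 1) = (((1 + ‖ξ n‖) ^ n)⁻¹ : ℝ) •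
      L (J n) ⟨character (ξ n), character_mem_smoothOn Ω _⟩ := by
    change L (J n) (characterSeriesLM Ω ξ (lp.single 1 n 1)) = _
    rw [characterSeriesLM_single, LinearMap.map_smul_of_tower]
  have hp : 0 < (1 + ‖ξ n‖) ^ n := by positivity
  rw [h2, norm_smul, Real.norm_of_nonneg (by positivity), inv_mul_le_iff₀ hp] at h1
  have h3 := hJ n
  nlinarith

/-- The functional `h ↦ ∫ F h` for a smooth function `F` with compact support in `Ω`. -/
def schwartzPairing {Ω : Opens (Eu d)} (F : 𝓢(Eu d, ℂ)) (hF : HasCompactSupport F)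
    (hFΩ : tsupport F ⊆ Ω) : smoothOn Ω →ₗ[ℂ] ℂ where
  toFun h := ∫ x, F x * (h : Eu d → ℂ) x
  map_add' h h' := by
    have hi : ∀ h : smoothOn Ω, Integrable fun x => F x * (h : Eu d → ℂ) x := fun h =>
      (contDiff_mul_of_tsupport_subset (F.smooth ⊤) hFΩ h.2).continuous
        |>.integrable_of_hasCompactSupport
        (hasCompactSupport_mul_left hF)
    rw [← integral_add (hi h) (hi h')]
    simp [mul_add]
  map_smul' a h := by
    rw [RingHom.id_apply, smul_eq_mul, ← integral_const_mul]
    simp [mul_left_comm]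

/-- The functionals `(T - F j) / δ j` are pointwise bounded, so the uniform bound on characters
applies to them. -/
theorem exists_uniform_fourier_bound {Ω : Opens (Eu d)} {T : CompactDistribution Ω}
    {F : ℕ → 𝓢(Eu d, ℂ)} (hF : ∀ j, HasCompactSupport (F j)) (hFΩ : ∀ j, tsupport (F j) ⊆ Ω)
    {δ : ℕ → ℝ} (hδ : ∀ j, 0 < δ j)
    (hbd : ∀ h : smoothOn Ω, ∃ C, ∀ j,
      ‖T.toLinearMap h - ∫ x, F j x * (h : Eu d → ℂ) x‖ ≤ C * δ j) :
    ∃ N : ℕ, ∀ j w, ‖T.fourier ((2 * Real.pi) • w) - 𝓕 (F j) w‖ ≤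
      N * δ j * (1 + ‖(2 * Real.pi) • w‖) ^ N := by
  obtain ⟨K, N₀, C₀, -, -, hC₀, hT⟩ := T.continuous'
  set L : ℕ → smoothOn Ω →ₗ[ℂ] ℂ := fun j =>
    ((δ j)⁻¹ : ℂ) • (T.toLinearMap - schwartzPairing (F j) (hF j) (hFΩ j)) with hL
  have hLnorm : ∀ j h, ‖L j h‖ =
      (δ j)⁻¹ * ‖T.toLinearMap h - ∫ x, F j x * (h : Eu d → ℂ) x‖ := fun j h => by
    rw [hL, LinearMap.smul_apply, norm_smul, norm_inv, Complex.norm_real,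
      Real.norm_of_nonneg (hδ j).le]
    rfl
  have hcont : ∀ j, ∃ (N : ℕ) (C : ℝ), ∀ (f : smoothOn Ω) (B : ℝ), 0 ≤ B →
      (∀ n ≤ N, ∀ x, ‖iteratedFDeriv ℝ n (f : Eu d → ℂ) x‖ ≤ B) → ‖L j f‖ ≤ C * B := by
    intro j
    refine ⟨N₀, (δ j)⁻¹ * (C₀ + ∫ x, ‖F j x‖), fun f B hB hf => ?_⟩
    have h1 := hT f B hB fun n hn x _ => hf n hn x
    have h2 : ‖∫ x, F j x * (f : Eu d → ℂ) x‖ ≤ (∫ x, ‖F j x‖) * B := by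
      rw [← integral_mul_const]
      refine norm_integral_le_of_norm_le ((F j).integrable.norm.mul_const _)
        (Eventually.of_forall fun x => ?_)
      rw [norm_mul]
      gcongr
      simpa using hf 0 (Nat.zero_le _) x
    rw [hLnorm, mul_assoc, add_mul]
    have := inv_pos.2 (hδ j)
    gcongr
    exact (norm_sub_le _ _).trans (add_le_add h1 h2)
  obtain ⟨N, hN⟩ := exists_uniform_character_bound L hcont fun h => by
    obtain ⟨C, hC⟩ := hbd h
    refine ⟨C, fun j => ?_⟩
    rw [hLnorm, inv_mul_le_iff₀ (hδ j), mul_comm]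
    exact hC j
  refine ⟨N, fun j w => ?_⟩
  have h := hN j ((2 * Real.pi) • w)
  rw [hLnorm, inv_mul_le_iff₀ (hδ j)] at h
  rw [← integral_mul_character]
  exact h.trans_eq (by ring)

/-! ### Interpolation between the two bounds -/

theorem exists_epsSeq_near {x : ℝ} (hx : 0 < x) (hx1 : x ≤ 1) :
    ∃ j, (epsSeq j : ℝ) ≤ x ∧ x ≤ 2 * epsSeq j := by
  obtain ⟨n, h1, h2⟩ := exists_nat_pow_near_of_lt_one hx hx1 (y := (1 / 2 : ℝ)) (by norm_num)
    (by norm_num)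
  refine ⟨n, h1.le, h2.trans (le_of_eq ?_)⟩
  rw [epsSeq_coe, pow_succ]
  ring

/-- Take `ε` comparable to `X ^ (-m)` with `m = (N + κ) / b`. Then `ε ^ b * X ^ N ≤ X ^ (-κ)`, while
with `a = η / (m + 1)` the loss `ε ^ (-a)` is at most `2 ^ η * X ^ η`. The `+ 1` also ensures `a ≤
η`. -/
theorem le_rpow_of_forall_epsSeq {A B b κ η t X : ℝ} {N : ℕ} (hb : 0 < b) (hκ : 0 ≤ κ)
    (hη : 0 < η) (hA : 0 ≤ A) (hB : 0 ≤ B) (hX : 1 ≤ X)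
    (h : ∀ j, t ≤ A * (epsSeq j : ℝ) ^ (-(η / ((N + κ) / b + 1))) * X ^ (-κ) +
      B * (epsSeq j : ℝ) ^ b * X ^ N) :
    t ≤ (A * 2 ^ η + B) * X ^ (-κ + η) := by
  set m := (N + κ) / b with hm
  have hm0 : 0 ≤ m := by positivity
  set a := η / (m + 1) with ha
  have ha0 : 0 < a := by positivity
  have ham : m * a ≤ η := by
    rw [ha, mul_div_assoc', div_le_iff₀ (by positivity)]
    nlinarith
  have haη : a ≤ η := by
    rw [ha, div_le_iff₀ (by positivity)]
    nlinarith
  have hX0 : 0 < X := by linarith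
  obtain ⟨j, hj1, hj2⟩ := exists_epsSeq_near (x := X ^ (-m)) (Real.rpow_pos_of_pos hX0 _)
    (Real.rpow_le_one_of_one_le_of_nonpos hX (by linarith))
  have hε := (epsSeq j).2.1
  have h1 : (epsSeq j : ℝ) ^ (-a) ≤ 2 ^ η * X ^ η := by
    have : X ^ (-m) / 2 ≤ epsSeq j := by linarith
    calc (epsSeq j : ℝ) ^ (-a) ≤ (X ^ (-m) / 2) ^ (-a) :=
          Real.rpow_le_rpow_of_nonpos (by positivity) this (by linarith)
      _ = 2 ^ a * X ^ (m * a) := by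
          rw [Real.div_rpow (by positivity) (by norm_num), ← Real.rpow_mul hX0.le,
            Real.rpow_neg (x := 2) (by norm_num), div_inv_eq_mul, neg_mul_neg, mul_comm]
      _ ≤ 2 ^ η * X ^ η := by
          gcongr
          norm_num
  have h2 : (epsSeq j : ℝ) ^ b ≤ X ^ (-(N + κ)) := by
    calc (epsSeq j : ℝ) ^ b ≤ (X ^ (-m)) ^ b := by gcongr
      _ = X ^ (-(N + κ)) := by
          rw [← Real.rpow_mul hX0.le, hm]
          congr 1
          field_simp
  have h3 : X ^ (-(N + κ)) * X ^ N ≤ X ^ (-κ + η) := by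
    rw [← Real.rpow_natCast X N, ← Real.rpow_add hX0]
    exact Real.rpow_le_rpow_of_exponent_le hX (by linarith)
  calc t ≤ _ := h j
    _ ≤ A * (2 ^ η * X ^ η) * X ^ (-κ) + B * X ^ (-(N + κ)) * X ^ N := by gcongr
    _ = A * 2 ^ η * X ^ (-κ + η) + B * (X ^ (-(N + κ)) * X ^ N) := by
        rw [Real.rpow_add hX0]
        ring
    _ ≤ A * 2 ^ η * X ^ (-κ + η) + B * X ^ (-κ + η) := by gcongr
    _ = _ := by ring

theorem one_add_pow_le {t : ℝ} (ht : 0 ≤ t) (N : ℕ) : (1 + t) ^ N ≤ 2 ^ N * (1 + t ^ 2) ^ N := by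
  rw [← mul_pow]
  gcongr
  nlinarith [sq_nonneg (t - 1)]

/-! ### Nets associated with a distribution -/

/-- The test function depends on `h` but not on `j`, so both convergence and its rate carry over
from test functions to all smooth `h`. -/
theorem exists_weakLimit {Ω : Opens (Eu d)} {T : CompactDistribution Ω} {f : Net Ω}
    {U : Set (Eu d)} (hU : RelCompact U Ω) (hT : T.supp ⊆ U)
    (hsupp : ∀ ε, supportIn Ω (f ε) ⊆ U) :
    ∃ F : ℕ → 𝓢(Eu d, ℂ), (∀ j, ∀ x ∈ Ω, F j x = (f (epsSeq j) : Eu d → ℂ) x) ∧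
      (∀ j, tsupport (F j) ⊆ U) ∧ ∀ h : smoothOn Ω, ∃ ρ : 𝓓(Ω, ℂ), ∀ j,
        T.toLinearMap h - ∫ x, F j x * (h : Eu d → ℂ) x =
          T.pair ρ - pairSmooth (f (epsSeq j)) ρ := by
  choose F hF hFU using fun j => exists_schwartz_extension hU (f (epsSeq j)) (hsupp _)
  refine ⟨F, hF, hFU, fun h => ?_⟩
  obtain ⟨ρ, h1, h2⟩ := T.exists_testFunction_eq hU hT h
  exact ⟨ρ, fun j => by rw [h1, pairSmooth_eq_integral hU _ (hF j) (hFU j) ρ h2]⟩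

theorem Associated.weakLimit {Ω : Opens (Eu d)} {T : CompactDistribution Ω} {f : Net Ω}
    (hfT : Associated f T) {F : ℕ → 𝓢(Eu d, ℂ)}
    (hF : ∀ h : smoothOn Ω, ∃ ρ : 𝓓(Ω, ℂ), ∀ j,
        T.toLinearMap h - ∫ x, F j x * (h : Eu d → ℂ) x =
          T.pair ρ - pairSmooth (f (epsSeq j)) ρ) : WeakLimit T F := by
  intro h
  obtain ⟨ρ, hρ⟩ := hF h
  have h1 := (hfT ρ).comp tendsto_epsSeq
  have h2 := h1.const_sub (T.toLinearMap h)
  rw [sub_zero] at h2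
  refine h2.congr fun j => ?_
  rw [Function.comp_apply, ← hρ j, sub_sub_cancel]

theorem StronglyAssociated.associated {Ω : Opens (Eu d)} {T : CompactDistribution Ω} {f : Net Ω}
    (hfT : StronglyAssociated f T) : Associated f T := by
  obtain ⟨b, hb, h⟩ := hfT
  refine fun ρ => (h ρ).trans_tendsto ?_
  have h1 : Tendsto (fun ε : Eps => (ε : ℝ)) epsZero (𝓝 0) := tendsto_comap
  have h2 := h1.rpow_const (p := b) (Or.inr hb.le)
  rwa [Real.zero_rpow hb.ne'] at h2

theorem exists_bound_epsSeq_of_isBigO {Ω : Opens (Eu d)} {T : CompactDistribution Ω} {f : Net Ω}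
    {b : ℝ} {ρ : 𝓓(Ω, ℂ)} (h : (fun ε => T.pair ρ - pairSmooth (f ε) ρ) =O[epsZero]
      (fun ε : Eps => (ε : ℝ) ^ b)) :
    ∃ C, ∀ j, ‖T.pair ρ - pairSmooth (f (epsSeq j)) ρ‖ ≤ C * (epsSeq j : ℝ) ^ b := by
  obtain ⟨C, hC⟩ := h.bound
  have hp : ∀ j, 0 < (epsSeq j : ℝ) ^ b := fun j => Real.rpow_pos_of_pos (epsSeq j).2.1 _
  obtain ⟨M, -, hM⟩ := exists_bound_of_eventually (C := C) hp
    (u := fun j => ‖T.pair ρ - pairSmooth (f (epsSeq j)) ρ‖) (by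
      filter_upwards [tendsto_epsSeq.eventually hC] with j hj
      rwa [Real.norm_of_nonneg (hp j).le] at hj)
  exact ⟨M, hM⟩

theorem exists_fourier_bound {Ω : Opens (Eu d)} {U : Set (Eu d)} (hU : RelCompact U Ω)
    {f : Net Ω} {F : ℕ → 𝓢(Eu d, ℂ)}
    (hF : ∀ j, ∀ x ∈ Ω, F j x = (f (epsSeq j) : Eu d → ℂ) x) (hFU : ∀ j, tsupport (F j) ⊆ U)
    {k : ℕ} {a : ℝ} (ha : a ∈ exponents U k f) :
    ∃ A : ℝ, 0 ≤ A ∧ ∀ j w, ‖𝓕 (F j) w‖ ≤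
      A * (epsSeq j : ℝ) ^ (-a) * (1 + ‖(2 * Real.pi) • w‖ ^ 2) ^ (-(k : ℝ) / 2) := by
  have hUv : volume U ≠ ⊤ :=
    ((measure_mono subset_closure).trans_lt hU.2.1.measure_lt_top).ne
  obtain ⟨M, hM0, hM⟩ := exists_partialD_bound hU hF hFU ha
  refine ⟨(2 + 2 * d : ℝ) ^ ((k : ℝ) / 2) * (M * volume.real U), by positivity, fun j w => ?_⟩
  refine (norm_fourier_le_of_partialD_bound hUv (hFU j) (hM j) w).trans (le_of_eq ?_)
  ring

/-! ### Regularity of `T` for attained and for non-attained calibrations. -/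

theorem regularity_of_bounded {Ω : Opens (Eu d)} {φ : 𝓢(Eu d, ℂ)} (hφ : ∫ t, φ t = 1)
    (P : LittlewoodPaley d) {T : CompactDistribution Ω} {k : ℕ} {f : Net Ω}
    {U : Set (Eu d)} (hU : RelCompact U Ω) (hT : T.supp ⊆ U)
    (hsupp : ∀ ε, supportIn Ω (f ε) ⊆ U) (h0 : (0 : ℝ) ∈ exponents U k f)
    (hfT : Associated f T) :
    (∃ C : ℝ, 0 < C ∧ ∀ ξ, ‖T.fourier ξ‖ ≤ C * (1 + ‖ξ‖ ^ 2) ^ (-(k : ℝ) / 2)) ∧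
      EmbeddingMem φ T (colombeauClass Ω (k : ℕ∞) ((d : ℝ) : EReal)) ∧
      T.toTempered ∈ P.zygmund ((k : ℝ) - d) := by
  obtain ⟨F, hF, hFU, hlim⟩ := exists_weakLimit hU hT hsupp
  have hTF := hfT.weakLimit hlim
  obtain ⟨M, -, hM⟩ := exists_partialD_bound hU hF hFU h0
  obtain ⟨A, hA0, hA⟩ := exists_fourier_bound hU hF hFU h0
  simp only [neg_zero, Real.rpow_zero, mul_one] at hM hA
  refine ⟨⟨A + 1, by positivity, fun ξ => ?_⟩, ?_, ?_⟩
  · refine (hTF.norm_fourier_le (B := fun ξ => A * (1 + ‖ξ‖ ^ 2) ^ (-(k : ℝ) / 2)) hA ξ).trans ?_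
    gcongr
    linarith
  -- The argument yields second index `0`; only `0 ≤ d` is needed to reach the stated class.
  · exact hTF.embeddingMem hU hT hFU hM hφ (by exact_mod_cast Nat.cast_nonneg d)
  · refine hTF.mem_zygmund P hA0 (N := 0) (κ := fun _ => 0) tendsto_const_nhds (fun _ => le_rfl)
      fun j w => ?_
    simpa using hA j w

theorem regularity_of_stronglyAssociated {Ω : Opens (Eu d)}
    (P : LittlewoodPaley d) {T : CompactDistribution Ω} {k : ℕ} {f : Net Ω}
    {U : Set (Eu d)} (hU : RelCompact U Ω) (hT : T.supp ⊆ U)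
    (hsupp : ∀ ε, supportIn Ω (f ε) ⊆ U) (h0 : ∀ a : ℝ, 0 < a → a ∈ exponents U k f)
    (hfT : StronglyAssociated f T) {η : ℝ} (hη : 0 < η) :
    (∃ C : ℝ, 0 < C ∧ ∀ ξ, ‖T.fourier ξ‖ ≤ C * (1 + ‖ξ‖ ^ 2) ^ (-(k : ℝ) / 2 + η)) ∧
      T.toTempered ∈ P.zygmund ((k : ℝ) - d - 2 * η) := by
  obtain ⟨F, hF, hFU, hlim⟩ := exists_weakLimit hU hT hsupp
  have hTF := hfT.associated.weakLimit hlim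
  obtain ⟨b, hb, hbT⟩ := hfT
  have hUΩ : U ⊆ Ω := subset_closure.trans hU.2.2
  have hp : ∀ j, 0 < (epsSeq j : ℝ) ^ b := fun j => Real.rpow_pos_of_pos (epsSeq j).2.1 _
  obtain ⟨N, hN⟩ := exists_uniform_fourier_bound (T := T) (F := F)
    (fun j => hU.2.1.of_isClosed_subset (isClosed_tsupport _) ((hFU j).trans subset_closure))
    (fun j => (hFU j).trans hUΩ) hp fun h => by
      obtain ⟨ρ, hρ⟩ := hlim h
      obtain ⟨C, hC⟩ := exists_bound_epsSeq_of_isBigO (hbT ρ)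
      exact ⟨C, fun j => by rw [hρ]; exact hC j⟩
  -- The exponent `a` depends on `N`, so the uniform bound has to precede the choice of the
  -- calibration exponent.
  have ha : 0 < η / ((N + (k : ℝ) / 2) / b + 1) := by positivity
  obtain ⟨A, hA0, hA⟩ := exists_fourier_bound hU hF hFU (h0 _ ha)
  have hfour : ∀ w, ‖T.fourier ((2 * Real.pi) • w)‖ ≤ (A * 2 ^ η + N * 2 ^ N) *
      (1 + ‖(2 * Real.pi) • w‖ ^ 2) ^ (-(k : ℝ) / 2 + η) := by
    intro w
    rw [neg_div]
    refine le_rpow_of_forall_epsSeq (N := N) hb (by positivity) hη hA0 (by positivity)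
      (le_add_of_nonneg_right (by positivity)) fun j => ?_
    have h1 := norm_le_norm_sub_add (T.fourier ((2 * Real.pi) • w)) (𝓕 (F j) w)
    have h2 := hN j w
    have h3 := hA j w
    have h4 : N * (epsSeq j : ℝ) ^ b * (1 + ‖(2 * Real.pi) • w‖) ^ N ≤
        N * 2 ^ N * (epsSeq j : ℝ) ^ b * (1 + ‖(2 * Real.pi) • w‖ ^ 2) ^ N := by
      calc _ ≤ N * (epsSeq j : ℝ) ^ b * (2 ^ N * (1 + ‖(2 * Real.pi) • w‖ ^ 2) ^ N) := by
            have := hp j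
            gcongr
            exact one_add_pow_le (norm_nonneg _) N
        _ = _ := by ring
    rw [neg_div] at h3
    linarith
  set C := A * 2 ^ η + N * 2 ^ N with hC
  have hC0 : 0 ≤ C := by positivity
  refine ⟨⟨C + 1, by positivity, fun ξ => ?_⟩, ?_⟩
  · have h1 := hfour ((2 * Real.pi)⁻¹ • ξ)
    rw [smul_inv_smul₀ Real.two_pi_pos.ne'] at h1
    refine h1.trans ?_
    gcongr
    linarith
  · have e : (k : ℝ) - d - 2 * η = (k - 2 * η) - d := by ring
    rw [e]
    -- The transform of `F j` is bounded by that of `T`, which has the decay just proved, plus the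
    -- strong association error, which tends to zero with `j`.
    refine hTF.mem_zygmund P hC0 (N := N) (κ := fun j => N * (epsSeq j : ℝ) ^ b) ?_
      (fun j => mul_nonneg (Nat.cast_nonneg _) (hp j).le) fun j w => ?_
    · have h1 := (tendsto_epsSeq_coe.rpow_const (p := b) (Or.inr hb.le)).const_mul (N : ℝ)
      rwa [Real.zero_rpow hb.ne', mul_zero] at h1
    · have h1 := norm_le_norm_sub_add (𝓕 (F j) w) (T.fourier ((2 * Real.pi) • w))
      rw [norm_sub_rev] at h1
      have h2 := hfour w
      have e' : -((k : ℝ) - 2 * η) / 2 = -(k : ℝ) / 2 + η := by ring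
      rw [e']
      linarith [hN j w]

end Gen

end

theorem mainTheorem1 (d : ℕ) (Ω : TopologicalSpace.Opens (Gen.Eu d))
    (φ : 𝓢(Gen.Eu d, ℂ)) (hφ : Gen.IsMollifier φ) (P : Gen.LittlewoodPaley d)
    (T : Gen.CompactDistribution Ω) (k : ℕ) (f : Gen.Net Ω)
    (hf : f ∈ Gen.moderateClass Ω (k : ℕ∞) 0)
    (U : Set (Gen.Eu d)) (hU : Gen.RelCompact U Ω) (hT : T.supp ⊆ U)
    (hsupp : ∀ ε, Gen.supportIn Ω (f ε) ⊆ U) :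
    ((Gen.CalibrationReachedAt U k f 0 ∨
          ∃ s : ℝ, s < 0 ∧ f ∈ Gen.moderateClass Ω (k : ℕ∞) (s : EReal)) →
        Gen.Associated f T →
        (∃ C : ℝ, 0 < C ∧ ∀ ξ, ‖T.fourier ξ‖ ≤ C * (1 + ‖ξ‖ ^ 2) ^ (-(k : ℝ) / 2)) ∧
          Gen.EmbeddingMem φ T (Gen.colombeauClass Ω (k : ℕ∞) ((d : ℝ) : EReal)) ∧
          T.toTempered ∈ P.zygmund ((k : ℝ) - d)) ∧
      (Gen.calibration U k f = 0 → ¬ Gen.CalibrationReachedAt U k f 0 →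
        Gen.StronglyAssociated f T →
        (∀ η : ℝ, 0 < η → ∃ C : ℝ, 0 < C ∧
            ∀ ξ, ‖T.fourier ξ‖ ≤ C * (1 + ‖ξ‖ ^ 2) ^ (-(k : ℝ) / 2 + η)) ∧
          ∀ η : ℝ, 0 < η → η < 1 → T.toTempered ∈ P.zygmund ((k : ℝ) - d - η)) := by
  refine ⟨fun h hfT => ?_, fun h0 _ hfT => ?_⟩
  · refine Gen.regularity_of_bounded hφ.1 P hU hT hsupp ?_ hfT
    rcases h with h | ⟨s, hs, h⟩
    · exact h.2
    · exact Gen.zero_mem_exponents_of_moderateClass_neg hU hs h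
  · have hexp : ∀ a : ℝ, 0 < a → a ∈ Gen.exponents U k f := fun a ha => by
      refine Gen.exists_mem_exponents_of_calibration_lt ?_
      rw [h0]
      exact_mod_cast ha
    refine ⟨fun η hη =>
      (Gen.regularity_of_stronglyAssociated P hU hT hsupp hexp hfT hη).1, fun η hη _ => ?_⟩
    -- A loss `η` in the exponent of `1 + ‖ξ‖²` is a loss `2η` of Zygmund regularity, hence `η / 2`.
    have := (Gen.regularity_of_stronglyAssociated P hU hT hsupp hexp hfT (half_pos hη)).2
    rwa [mul_div_cancel₀ η (two_ne_zero' ℝ)] at this
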